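/- **Setting.** A *circuit DAG* is a topologically sorted directed acyclic graph $G=(V,E)$, $V=\{v_1,\dots,v_n\}$, $|E|=m$ (every edge $(v_i,v_j)$ has $i<j$), whose sinks are its last vertices; $\hat n$ is the number of non-sink vertices. Each sink is labeled with a Boolean variable; each non-sink vertex $v_i$ has out-degree $d_i\ge 2$ and is labeled with a gate; each edge is labeled with a bit ($0$ means that the value passed along the edge is negated); and one non-sink vertex $v_s$ is the root. The value of a sink is the value of its variable, the value of a non-sink vertex is its gate applied to the (possibly negated) values of its out-neighbours, and the circuit evaluates to the value of $v_s$. It is an *XOR-AND DAG* if every gate is an AND (of any fan-in $\ge2$) or a binary XOR (out-degree exactly $2$), and an *AND-OR-NOT DAG* if every gate is an AND or an OR. Running time is the number of accesses to a black box, which gives the gate labels, the out-degrees, the adjacency lists with the edge labels, the values of the variables at the sinks, and the stored results. Algorithms are classical programs that may call quantum query algorithms as subroutines; when each input bit of a subroutine is itself computed by at most $q$ black-box queries, each query of the subroutine to its input costs $2q$. **Algorithm.** Let $(\hat Q_h^{k,d})$, $h\in\{\mathrm{AND},\mathrm{OR}\}$, $k,d\ge1$, be a family of quantum query algorithms such that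 $\hat Q_h^{k,d}$ computes $h$ on $d$ bits with $O(\sqrt{kd})$ queries and error probability $O(2^{-k})$. Put $k=\lceil 2\log_2\hat n\rceil$. The algorithm processes the vertices $v_{\hat n},v_{\hat n-1},\dots,v_s$ in this order: for an AND vertex it runs $\hat Q^{k,d_i}_{\mathrm{AND}}$ on its $d_i$ arguments and stores the result; for an XOR vertex with arguments $a,b$ it does so for the two AND gates $a\wedge\neg b$, $\neg a\wedge b$ and then for the OR of the two stored results. It returns the stored value of $v_s$. **Theorem.** (i) Let $G'$ be obtained from an XOR-AND DAG $G$ by replacing each XOR gate with two AND gates and one OR gate, with negated edges, according to $a\oplus b=(a\wedge\neg b)\vee(\neg a\wedge b)$. Then $G'$ is an AND-OR-NOT DAG that represents the same Boolean function as $G$; it has $\hat n'\le 3\hat n$ non-sink vertices and $m'\le 6m$ edges. (ii) There are a family $(\hat Q_h^{k,d})$ as above and a universal constant $C$ such that, for every XOR-AND DAG $G$ with $\hat n\ge 2$ and every assignment of the variables, the algorithm above has running time at most $C\sqrt{\hat n m\log\hat n}$, hence also at most $C\sqrt{nm\log n}$, and it returns a value other than the value of $G$ with probability at most $C/\hat n$.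 -/

import Mathlib

/-! ## Gates and circuits on directed acyclic graphs -/

/-- The functions computed at the function-vertices. -/
inductive Gate where
  | and
  | or
  | xor
deriving DecidableEq

/-- The Boolean function of `d` arguments computed by a gate. -/
def Gate.fn {d : ℕ} (g : Gate) (y : Fin d → Bool) : Bool :=
  match g with
  | .and => decide (∀ k, y k = true)
  | .or => decide (∃ k, y k = true)
  | .xor => decide (Odd (Finset.univ.filter (fun k => y k = true)).card)

/-- `b ^ σ` : the bit itself if the edge label is `1`, its negation if the edge label is `0`. -/
def lit (σ b : Bool) : Bool := if σ then b else !b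

/-- A Boolean circuit with shared inputs, as a topologically sorted DAG. `I` is the set of
non-sink vertices (function-vertices) in their order, `S` is the set of sinks (they come after all
the function-vertices), each sink being labelled by one of `N` Boolean variables. The graph is
given by its adjacency lists: `nbr i` is the list of out-neighbours of the vertex `i`
(without repetition, of length `deg i`), `sign i k` is the label of the `k`-th edge leaving `i`. -/
structure GateDag (I S : Type) [LinearOrder I] (N : ℕ) where
  gate : I → Gate
  deg : I → ℕ
  two_le_deg : ∀ i, 2 ≤ deg i
  nbr : ∀ i, Fin (deg i) → I ⊕ S
  nbr_injective : ∀ i, Function.Injective (nbr i)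
  lt_of_nbr : ∀ i k j, nbr i k = Sum.inl j → i < j
  sign : ∀ i, Fin (deg i) → Bool
  var : S → Fin N
  root : I

namespace GateDag

/-- The value of the function-vertex `i` when the variables have the values `x`. -/
def innerValue {I S : Type} [LinearOrder I] [Fintype I] {N : ℕ} (G : GateDag I S N)
    (x : Fin N → Bool) (i : I) : Bool :=
  (G.gate i).fn fun k =>
    lit (G.sign i k)
      (match _h : G.nbr i k with
        | .inl j => G.innerValue x j
        | .inr s => x (G.var s))
termination_by (wellFounded_gt (α := I)).wrap i
decreasing_by exact G.lt_of_nbr i k j _h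

/-- The Boolean function represented by the circuit: the value at the root. -/
def value {I S : Type} [LinearOrder I] [Fintype I] {N : ℕ} (G : GateDag I S N)
    (x : Fin N → Bool) : Bool :=
  G.innerValue x G.root

/-- The number of edges. -/
def edgeCount {I S : Type} [LinearOrder I] [Fintype I] {N : ℕ} (G : GateDag I S N) : ℕ :=
  ∑ i, G.deg i

/-- XOR-AND DAGs: every gate is an AND (of any fan-in at least two) or a binary XOR. -/
def IsXorAnd {I S : Type} [LinearOrder I] {N : ℕ} (G : GateDag I S N) : Prop :=
  ∀ i, G.gate i = Gate.and ∨ (G.gate i = Gate.xor ∧ G.deg i = 2)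

/-- AND-OR-NOT DAGs: every gate is an AND or an OR; negations are on the edges. -/
def IsAndOrNot {I S : Type} [LinearOrder I] {N : ℕ} (G : GateDag I S N) : Prop :=
  ∀ i, G.gate i = Gate.and ∨ G.gate i = Gate.or

/-! ### Replacement of XOR gates: `a ⊕ b = (a ∧ ¬b) ∨ (¬a ∧ b)` -/

/-- The function-vertices after the replacement: `(i, 0)` carries the value of the old vertex `i`
(an old AND gate, or the OR that ends the replacement of an XOR); for every XOR vertex `i` there
are two further vertices `(i, 1)` and `(i, 2)`, its two ANDs. The order is lexicographic. -/
abbrev NewInner {I S : Type} [LinearOrder I] {N : ℕ} (G : GateDag I S N) : Type :=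
  {p : I ×ₗ Fin 3 // (ofLex p).2 ≠ 0 → G.gate (ofLex p).1 = Gate.xor}

noncomputable instance {I S : Type} [LinearOrder I] [Fintype I] {N : ℕ} (G : GateDag I S N) :
    Fintype G.NewInner :=
  haveI : Finite (I ×ₗ Fin 3) := inferInstanceAs (Finite (I × Fin 3))
  Fintype.ofFinite _

section Replace

variable {I S : Type} [LinearOrder I] {N : ℕ} (G : GateDag I S N)

/-- The old vertex that a new vertex belongs to. -/
def base (p : G.NewInner) : I := (ofLex p.1).1

/-- The role of a new vertex: `0`, `1` or `2`. -/
def role (p : G.NewInner) : Fin 3 := (ofLex p.1).2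

/-- The new vertex that carries the value of an old function-vertex. -/
def main (i : I) : G.NewInner := ⟨toLex (i, 0), fun h => absurd rfl h⟩

/-- The first (`k = 0`) and the second (`k = 1`) AND vertex for an XOR vertex. -/
def andVertex (i : I) (hi : G.gate i = Gate.xor) (k : Fin 2) : G.NewInner :=
  ⟨toLex (i, k.succ), fun _ => hi⟩

/-- Out-degrees in the new graph. -/
def newDeg (p : G.NewInner) : ℕ := if G.gate (G.base p) = Gate.xor then 2 else G.deg (G.base p)

theorem newDeg_le (p : G.NewInner) : G.newDeg p ≤ G.deg (G.base p) := by
  unfold newDeg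
  split_ifs
  · exact G.two_le_deg _
  · exact le_rfl

theorem two_le_newDeg (p : G.NewInner) : 2 ≤ G.newDeg p := by
  unfold newDeg
  split_ifs
  · exact le_rfl
  · exact G.two_le_deg _

/-- Adjacency lists of the new graph. The OR vertex of an XOR has its two AND vertices as
out-neighbours; every other new vertex inherits the out-neighbours of the old vertex. -/
def newNbr (p : G.NewInner) (k : Fin (G.newDeg p)) : G.NewInner ⊕ S :=
  if h : G.gate (G.base p) = Gate.xor ∧ G.role p = 0 then
    Sum.inl (G.andVertex (G.base p) h.1
      ⟨k.1, lt_of_lt_of_eq k.2 (by unfold newDeg; rw [if_pos h.1])⟩)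
  else
    Sum.map G.main id (G.nbr (G.base p) (k.castLE (G.newDeg_le p)))

/-- Edge labels of the new graph. The first AND vertex of an XOR negates its second argument, the
second AND vertex negates its first argument. -/
def newSign (p : G.NewInner) (k : Fin (G.newDeg p)) : Bool :=
  if G.gate (G.base p) = Gate.xor then
    if G.role p = 0 then true
    else lit (decide (k.1 + 1 = (G.role p).1)) (G.sign (G.base p) (k.castLE (G.newDeg_le p)))
  else G.sign (G.base p) (k.castLE (G.newDeg_le p))

/-- Each XOR gate is replaced by two AND gates and one OR gate. -/
def replaceXor : GateDag G.NewInner S N where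
  gate p :=
    if G.gate (G.base p) = Gate.xor then (if G.role p = 0 then Gate.or else Gate.and)
    else G.gate (G.base p)
  deg := G.newDeg
  two_le_deg := G.two_le_newDeg
  nbr := G.newNbr
  nbr_injective p k l hkl := by
    unfold newNbr at hkl
    split_ifs at hkl with h
    · have h1 := congrArg (fun v => (ofLex v.1).2.1) (Sum.inl_injective hkl)
      simp only [andVertex, ofLex_toLex, Fin.val_succ] at h1
      exact Fin.ext (by omega)
    · have hm : Function.Injective G.main := fun a b hab =>
        congrArg (fun v => (ofLex v.1).1) hab
      exact Fin.castLE_injective _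
        (G.nbr_injective _ (Function.Injective.sumMap hm Function.injective_id hkl))
  lt_of_nbr p k q hq := by
    unfold newNbr at hq
    rw [← Subtype.coe_lt_coe, Prod.Lex.lt_iff]
    split_ifs at hq with h
    · right
      rw [← Sum.inl_injective hq]
      refine ⟨rfl, ?_⟩
      have h0 : (ofLex p.1).2 = 0 := h.2
      rw [h0]
      exact Fin.succ_pos _
    · left
      cases hn : G.nbr (G.base p) (k.castLE (G.newDeg_le p)) with
      | inl j =>
        rw [hn] at hq
        rw [← Sum.inl_injective hq]
        exact G.lt_of_nbr _ _ _ hn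
      | inr s =>
        rw [hn] at hq
        exact absurd hq (by simp)
  sign := G.newSign
  var := G.var
  root := G.main G.root

end Replace

end GateDag

/-! ## Quantum query algorithms for Boolean functions of `d` bits -/

/-- Basis states: a query register (`none` is the idle query), an answer qubit, a workspace. -/
abbrev Reg (d w : ℕ) : Type := Option (Fin d) × Bool × Fin w

/-- A quantum query algorithm on `d` input bits: it starts in a basis state, applies
`U 0, O, U 1, O, …, O, U queries` (`O` the oracle of the input), and measures in the standard
basis at the end; `out` is the output for each measured basis state. -/
structure QAlg (d : ℕ) where
  work : ℕ
  queries : ℕ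
  U : Fin (queries + 1) → Matrix.unitaryGroup (Reg d work) ℂ
  start : Reg d work
  out : Reg d work → Bool

/-- The oracle `|i, b, z⟩ ↦ |i, b ⊕ y i, z⟩` (and the identity on idle queries). -/
def oracle {d w : ℕ} (y : Fin d → Bool) (ψ : Reg d w → ℂ) : Reg d w → ℂ := fun s =>
  match s with
  | (none, b, z) => ψ (none, b, z)
  | (some i, b, z) => ψ (some i, Bool.xor b (y i), z)

namespace QAlg

/-- The state after `t` queries and the unitary that follows them. -/
noncomputable def state {d : ℕ} (Q : QAlg d) (y : Fin d → Bool) :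
    (t : ℕ) → t < Q.queries + 1 → (Reg d Q.work → ℂ)
  | 0, h => ((Q.U ⟨0, h⟩ : Matrix _ _ ℂ)).mulVec (Pi.single Q.start 1)
  | t + 1, h =>
    ((Q.U ⟨t + 1, h⟩ : Matrix _ _ ℂ)).mulVec (oracle y (Q.state y t (Nat.lt_of_succ_lt h)))

/-- The probability that the algorithm outputs `b` on the input `y`. -/
noncomputable def prob {d : ℕ} (Q : QAlg d) (y : Fin d → Bool) (b : Bool) : ℝ :=
  ∑ s, if Q.out s = b then ‖Q.state y Q.queries (Nat.lt_succ_self _) s‖ ^ 2 else 0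

end QAlg

/-- A family of query algorithms: `Q h k d` is the `k`-fold boosted algorithm for the gate `h`
with `d` arguments. -/
abbrev GateAlgs : Type := Gate → ∀ _k d : ℕ, QAlg d

/-- The family is a boosted family for AND and OR: `O(√(k d))` queries and
error probability `O(1 / 2 ^ k)`. -/
def GateAlgs.IsBoosted (Q : GateAlgs) (c : ℝ) : Prop :=
  ∀ h : Gate, h = Gate.and ∨ h = Gate.or → ∀ k d : ℕ, 1 ≤ k → 1 ≤ d →
    ((Q h k d).queries : ℝ) ≤ c * √(k * d) ∧
      ∀ y : Fin d → Bool, (Q h k d).prob y (!(h.fn y)) ≤ c / 2 ^ k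

/-! ## The black box: graph structure, variables and stored data -/

/-- Cells of the array of stored results: `(i, 0)` is for the value of the vertex `i`, `(i, 1)` and
`(i, 2)` are for the two AND gates that occur in the computation of an XOR vertex `i`. -/
abbrev Cell (I : Type) : Type := I × Fin 3

/-- Queries: the label of a function-vertex, its out-degree, the `k`-th entry of its adjacency list
(with the label of that edge), the value of the variable at a sink, and a stored bit. -/
inductive Query (I S : Type) where
  | gate (i : I)
  | deg (i : I)
  | edge (i : I) (k : ℕ)
  | var (s : S)
  | mem (c : Cell I)

/-- Answers of the black box. -/
inductive Answer (I S : Type) where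
  | gate (g : Gate)
  | deg (d : ℕ)
  | edge (v : I ⊕ S) (σ : Bool)
  | bit (b : Bool)
  | invalid

/-- The black box for a circuit `G`, an assignment `x` and an array `μ` of stored bits. -/
def blackBox {I S : Type} [LinearOrder I] {N : ℕ} (G : GateDag I S N) (x : Fin N → Bool)
    (μ : Cell I → Bool) : Query I S → Answer I S
  | .gate i => .gate (G.gate i)
  | .deg i => .deg (G.deg i)
  | .edge i k => if h : k < G.deg i then .edge (G.nbr i ⟨k, h⟩) (G.sign i ⟨k, h⟩) else .invalid
  | .var s => .bit (x (G.var s))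
  | .mem c => .bit (μ c)

/-- A deterministic query procedure that computes one bit. -/
inductive Probe (I S : Type) where
  | ret (b : Bool)
  | ask (q : Query I S) (next : Answer I S → Probe I S)

namespace Probe

/-- The bit computed by the procedure. -/
def eval {I S : Type} (X : Query I S → Answer I S) : Probe I S → Bool
  | ret b => b
  | ask q next => (next (X q)).eval X

/-- The number of queries made by the procedure. -/
def cost {I S : Type} (X : Query I S → Answer I S) : Probe I S → ℕ
  | ret _ => 0
  | ask q next => 1 + (next (X q)).cost X

/-- The same procedure, followed by a negation. -/
def neg {I S : Type} : Probe I S → Probe I S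
  | ret b => ret (!b)
  | ask q next => ask q fun a => (next a).neg

end Probe

/-! ## Classical algorithms with quantum subroutines -/

/-- Classical programs that query the black box, write to the array of stored data, and call
quantum query algorithms as subroutines. The `k`-th input bit of a subroutine is the bit
computed by the procedure `arg k`. -/
inductive Prog (I S : Type) where
  | ret (b : Bool)
  | ask (q : Query I S) (next : Answer I S → Prog I S)
  | write (c : Cell I) (b : Bool) (next : Prog I S)
  | call (d : ℕ) (Q : QAlg d) (arg : Fin d → Probe I S) (next : Bool → Prog I S)

namespace Prog

/-- The probability that the program, started with stored data `μ`, returns `out`. -/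
noncomputable def prob {I S : Type} [LinearOrder I] {N : ℕ} (G : GateDag I S N)
    (x : Fin N → Bool) (out : Bool) : Prog I S → (Cell I → Bool) → ℝ
  | ret b, _ => if b = out then 1 else 0
  | ask q next, μ => (next (blackBox G x μ q)).prob G x out μ
  | write c b next, μ => next.prob G x out (Function.update μ c b)
  | call _ Q arg next, μ =>
    ∑ b : Bool, Q.prob (fun k => (arg k).eval (blackBox G x μ)) b * (next b).prob G x out μ

/-- The running time: the number of accesses to the black box (queries and writes), in the worst
case over the outcomes of the measurements. Each query of a subroutine to its input costs twice the
number of queries of the longest procedure `arg k`: the bit is computed coherently, and the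
computation is undone afterwards. -/
def time {I S : Type} [LinearOrder I] {N : ℕ} (G : GateDag I S N) (x : Fin N → Bool) :
    Prog I S → (Cell I → Bool) → ℕ
  | ret _, _ => 0
  | ask q next, μ => 1 + (next (blackBox G x μ q)).time G x μ
  | write c b next, μ => 1 + next.time G x (Function.update μ c b)
  | call _ Q arg next, μ =>
    Q.queries * (2 * Finset.univ.sup fun k => (arg k).cost (blackBox G x μ)) +
      max ((next false).time G x μ) ((next true).time G x μ)

end Prog

/-! ## The dynamic programming algorithm -/

/-- The current value of a vertex: a stored result, or the variable of a sink. -/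
def vertexProbe {I S : Type} : I ⊕ S → (Bool → Bool) → Probe I S
  | .inl j, f => .ask (.mem (j, 0)) fun
    | .bit b => .ret (f b)
    | _ => .ret false
  | .inr s, f => .ask (.var s) fun
    | .bit b => .ret (f b)
    | _ => .ret false

/-- The `k`-th argument of the vertex `i`: its `k`-th out-neighbour is looked up, then the value of
that neighbour, to which the label of the edge is applied. -/
def argProbe {I S : Type} (i : I) (k : ℕ) : Probe I S :=
  .ask (.edge i k) fun
    | .edge v σ => vertexProbe v (lit σ)
    | _ => .ret false

/-- A stored bit. -/
def memProbe {I S : Type} (c : Cell I) : Probe I S :=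
  .ask (.mem c) fun
    | .bit b => .ret b
    | _ => .ret false

/-- One gate `h` with `d` arguments: run the boosted algorithm, store the result in the cell `c`. -/
def gateStep {I S : Type} (Q : GateAlgs) (k : ℕ) (h : Gate) (c : Cell I) (d : ℕ)
    (arg : Fin d → Probe I S) (rest : Prog I S) : Prog I S :=
  .call d (Q h k d) arg fun b => .write c b rest

/-- Processing a vertex. AND and OR vertices are one gate on all their arguments. An XOR
vertex with arguments `a, b` is processed as two AND gates and one OR gate:
`(a ∧ ¬b) ∨ (¬a ∧ b)`. -/
def vertexStep {I S : Type} (Q : GateAlgs) (k : ℕ) (i : I) (rest : Prog I S) : Prog I S :=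
  .ask (.gate i) fun
    | .gate .xor =>
      gateStep Q k .and (i, 2) 2 ![(argProbe i 0).neg, argProbe i 1] <|
      gateStep Q k .and (i, 1) 2 ![argProbe i 0, (argProbe i 1).neg] <|
      gateStep Q k .or (i, 0) 2 ![memProbe (i, 1), memProbe (i, 2)] rest
    | .gate h =>
      .ask (.deg i) fun
        | .deg d => gateStep Q k h (i, 0) d (fun l => argProbe i l) rest
        | _ => .ret false
    | _ => .ret false

/-- The function-vertices from the last one down to the root `s` are processed one after the
other; then the stored value of the root is returned. The boosting parameter is
`⌈2 log₂ n̂⌉`, where `n̂` is the number of function-vertices. -/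
noncomputable def dagAlgorithm {I S : Type} [LinearOrder I] [Fintype I] (Q : GateAlgs) (s : I) :
    Prog I S :=
  (((Finset.univ : Finset I).filter (s ≤ ·)).sort (· ≥ ·)).foldr
    (vertexStep Q ⌈2 * Real.logb 2 (Fintype.card I)⌉₊)
    (.ask (.mem (s, 0)) fun
      | .bit b => .ret b
      | _ => .ret false)

/-!
Part (i) is a check of values by induction from the last vertex down: the two new AND vertices of an
XOR vertex see the same arguments as the old vertex, one of them negated.

For part (ii) the substance is the existence of query algorithms for OR on `d` bits with `O(√(k d))`
queries and error `2 ^ (-k)`. They are sequences of Grover tests. A test has a parameter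
`a ∈ [0, 1]` and starts in `S = (√(1 - a) |none⟩ + √(a / d) ∑ᵢ |i⟩) ⊗ |-⟩`, on which the oracle acts
by signs, with `⟨S, O S⟩ = 1 - 2 a t / d` if the input has `t` ones. The plane of `S` and `O S` is
invariant under the oracle and under the reflection about `S`, so that after `n` queries the
amplitude of `S` is the Chebyshev polynomial `T n` at `1 - 2 a t / d`
(`run_replicate_reflection`, `run_testUnitaries`). Then `S` is exchanged with the starting state of
the next test, which carries the next label in the workspace; whatever is orthogonal to `S` keeps a
smaller label forever and signals that a one has been found. Hence the probability of the output
`false` is the product of the squares of these amplitudes (`prob_searchAlg_false`). It is `1` for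
`t = 0`, as `T n` is `1` at `1`.

For given `t₀` and `n ≥ √(d / t₀)` the weight `a` can be chosen such that `T n` vanishes at
`t = t₀` (`eval_T_testWeight_eq_zero`), and then its square is at most `4 / 5` for
`t₀ / 2 ≤ t ≤ t₀` (`eval_T_testWeight_sq_le`). With `K = min k d`, one test for each of
`t₀ = 1, …, K` excludes any error for `t ≤ K`, and `4 k` tests for each `t₀ = K 2 ^ (i + 1)` make
the error at most `(4 / 5) ^ (4 k) ≤ 2 ^ (-k)` for `t > K`. The numbers of queries sum to `O(√(k d))`,
because `∑ 1 / √t₀` over `t₀ ≤ K` is at most `2 √K`, and the second kind of tests costs a geometric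
sum (`exists_boosted_or`). AND follows by De Morgan's law.

The running time of the dynamic program is `∑ᵢ O(√(k dᵢ)) + O(n̂)`, to which the Cauchy-Schwarz
inequality is applied (`time_dagAlgorithm_le`). Its error probability is at most that of `3 n̂`
gates, each of which errs with probability `O(n̂ ^ (-2))` (`prob_dagAlgorithm_le`).
-/

/-! ### Query algorithms: linearity, normalization, sequences of unitaries -/

theorem oracle_add {d w : ℕ} (y : Fin d → Bool) (ψ φ : Reg d w → ℂ) :
    oracle y (ψ + φ) = oracle y ψ + oracle y φ := by
  funext ⟨o, b, z⟩
  cases o <;> rfl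

theorem oracle_sub {d w : ℕ} (y : Fin d → Bool) (ψ φ : Reg d w → ℂ) :
    oracle y (ψ - φ) = oracle y ψ - oracle y φ := by
  funext ⟨o, b, z⟩
  cases o <;> rfl

theorem oracle_smul {d w : ℕ} (y : Fin d → Bool) (α : ℂ) (ψ : Reg d w → ℂ) :
    oracle y (α • ψ) = α • oracle y ψ := by
  funext ⟨o, b, z⟩
  cases o <;> rfl

theorem oracle_oracle {d w : ℕ} (y : Fin d → Bool) (ψ : Reg d w → ℂ) :
    oracle y (oracle y ψ) = ψ := by
  funext ⟨o, b, z⟩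
  cases o <;> simp [oracle]

theorem oracle_false {d w : ℕ} (ψ : Reg d w → ℂ) : oracle (fun _ => false) ψ = ψ := by
  funext ⟨o, b, z⟩
  cases o <;> simp [oracle]

/-- The permutation of the basis states that the oracle carries out. -/
def oraclePerm {d : ℕ} (w : ℕ) (y : Fin d → Bool) : Equiv.Perm (Reg d w) :=
  Function.Involutive.toPerm
    (fun s => match s with
      | (none, b, z) => (none, b, z)
      | (some i, b, z) => (some i, Bool.xor b (y i), z))
    (by rintro ⟨_ | i, b, z⟩ <;> simp)

theorem oracle_eq_comp {d w : ℕ} (y : Fin d → Bool) (ψ : Reg d w → ℂ) (s : Reg d w) :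
    oracle y ψ s = ψ (oraclePerm w y s) := by
  obtain ⟨_ | i, b, z⟩ := s <;> rfl

theorem sum_norm_sq_oracle {d w : ℕ} (y : Fin d → Bool) (ψ : Reg d w → ℂ) :
    ∑ s, ‖oracle y ψ s‖ ^ 2 = ∑ s, ‖ψ s‖ ^ 2 := by
  simp only [oracle_eq_comp]
  exact Equiv.sum_comp (oraclePerm w y) (fun s => ‖ψ s‖ ^ 2)

theorem ofReal_sum_norm_sq {ι : Type*} [Fintype ι] (ψ : ι → ℂ) :
    ((∑ s, ‖ψ s‖ ^ 2 : ℝ) : ℂ) = star ψ ⬝ᵥ ψ := by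
  simp [dotProduct, ← Complex.conj_mul']

theorem sum_norm_sq_mulVec {ι : Type*} [Fintype ι] [DecidableEq ι]
    (U : Matrix.unitaryGroup ι ℂ) (ψ : ι → ℂ) :
    ∑ s, ‖(U : Matrix ι ι ℂ).mulVec ψ s‖ ^ 2 = ∑ s, ‖ψ s‖ ^ 2 := by
  apply Complex.ofReal_injective
  rw [ofReal_sum_norm_sq, ofReal_sum_norm_sq, Matrix.star_mulVec, Matrix.dotProduct_mulVec,
    Matrix.vecMul_vecMul, ← Matrix.star_eq_conjTranspose, Unitary.coe_star_mul_self,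
    Matrix.vecMul_one]

namespace QAlg

theorem state_succ {d : ℕ} (Q : QAlg d) (y : Fin d → Bool) (t : ℕ) (ht : t + 1 < Q.queries + 1) :
    Q.state y (t + 1) ht = (Q.U ⟨t + 1, ht⟩ : Matrix _ _ ℂ).mulVec
      (oracle y (Q.state y t (Nat.lt_of_succ_lt ht))) := rfl

theorem sum_norm_sq_state {d : ℕ} (Q : QAlg d) (y : Fin d → Bool) (t : ℕ)
    (ht : t < Q.queries + 1) : ∑ s, ‖Q.state y t ht s‖ ^ 2 = 1 := by
  induction t with
  | zero =>
    rw [state, sum_norm_sq_mulVec, Finset.sum_eq_single Q.start]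
    · simp
    · intro s _ hs
      simp [hs]
    · simp
  | succ t ih => rw [state, sum_norm_sq_mulVec, sum_norm_sq_oracle, ih]

theorem prob_nonneg {d : ℕ} (Q : QAlg d) (y : Fin d → Bool) (b : Bool) : 0 ≤ Q.prob y b :=
  Finset.sum_nonneg fun s _ => by split_ifs <;> positivity

theorem prob_add_prob_not {d : ℕ} (Q : QAlg d) (y : Fin d → Bool) (b : Bool) :
    Q.prob y b + Q.prob y (!b) = 1 := by
  rw [← Q.sum_norm_sq_state y Q.queries (Nat.lt_succ_self _), prob, prob, ← Finset.sum_add_distrib]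
  refine Finset.sum_congr rfl fun s _ => ?_
  cases hs : Q.out s <;> cases b <;> simp

/-- The state after further queries, the `t`-th of which is followed by the `t`-th unitary of the
list. -/
noncomputable def run {d w : ℕ} (y : Fin d → Bool) :
    List (Matrix.unitaryGroup (Reg d w) ℂ) → (Reg d w → ℂ) → Reg d w → ℂ
  | [], ψ => ψ
  | U :: l, ψ => run y l ((U : Matrix _ _ ℂ).mulVec (oracle y ψ))

theorem run_append {d w : ℕ} (y : Fin d → Bool) (l l' : List (Matrix.unitaryGroup (Reg d w) ℂ))
    (ψ : Reg d w → ℂ) : run y (l ++ l') ψ = run y l' (run y l ψ) := by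
  induction l generalizing ψ with
  | nil => rfl
  | cons U l ih => exact ih _

/-- The query algorithm that makes one query before each unitary of the list `l`. -/
def ofList {d w : ℕ} (U₀ : Matrix.unitaryGroup (Reg d w) ℂ)
    (l : List (Matrix.unitaryGroup (Reg d w) ℂ)) (start : Reg d w) (out : Reg d w → Bool) :
    QAlg d where
  work := w
  queries := l.length
  U i := (U₀ :: l).get i
  start := start
  out := out

theorem state_ofList {d w : ℕ} (U₀ : Matrix.unitaryGroup (Reg d w) ℂ)
    (l : List (Matrix.unitaryGroup (Reg d w) ℂ)) (start : Reg d w) (out : Reg d w → Bool)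
    (y : Fin d → Bool) (t : ℕ) (ht : t < l.length + 1) :
    (ofList U₀ l start out).state y t ht =
      run y (l.take t) ((U₀ : Matrix _ _ ℂ).mulVec (Pi.single start 1)) := by
  induction t with
  | zero => rfl
  | succ t ih =>
    have h : t < l.length := by omega
    rw [← List.take_append_getElem h, run_append, ← ih (by omega)]
    rfl

theorem prob_ofList {d w : ℕ} (U₀ : Matrix.unitaryGroup (Reg d w) ℂ)
    (l : List (Matrix.unitaryGroup (Reg d w) ℂ)) (start : Reg d w) (out : Reg d w → Bool)
    (y : Fin d → Bool) (b : Bool) :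
    (ofList U₀ l start out).prob y b =
      ∑ s, if out s = b then
        ‖run y l ((U₀ : Matrix _ _ ℂ).mulVec (Pi.single start 1)) s‖ ^ 2 else 0 := by
  have h := state_ofList U₀ l start out y l.length (Nat.lt_succ_self _)
  rw [List.take_length] at h
  rw [← h]
  rfl

/-- The permutation matrix that flips the answer qubit unless the query is idle. -/
def flipUnitary (d w : ℕ) : Matrix.unitaryGroup (Reg d w) ℂ :=
  ⟨(oraclePerm w (fun _ : Fin d => true)).permMatrix ℂ, by
    rw [Matrix.mem_unitaryGroup_iff, Matrix.star_eq_conjTranspose, Matrix.conjTranspose_permMatrix,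
      ← Matrix.permMatrix_mul]
    simp⟩

theorem flipUnitary_mulVec_oracle {d w : ℕ} (y : Fin d → Bool) (ψ : Reg d w → ℂ) :
    (flipUnitary d w : Matrix _ _ ℂ).mulVec (oracle y ψ) = oracle (fun i => !(y i)) ψ := by
  funext s
  simp only [flipUnitary, Matrix.permMatrix_mulVec, Function.comp_apply, oracle_eq_comp]
  congr 1
  obtain ⟨_ | i, b, z⟩ := s
  · rfl
  · cases b <;> cases h : y i <;> simp [oraclePerm, Function.Involutive.toPerm, h]

/-- The algorithm `Q` run on the negated input bits, with negated output. -/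
def dual {d : ℕ} (Q : QAlg d) : QAlg d where
  work := Q.work
  queries := Q.queries
  U i := if i.1 = 0 then Q.U i else Q.U i * flipUnitary d Q.work
  start := Q.start
  out s := !(Q.out s)

theorem state_dual {d : ℕ} (Q : QAlg d) (y : Fin d → Bool) (t : ℕ) (ht : t < Q.queries + 1) :
    Q.dual.state y t ht = Q.state (fun i => !(y i)) t ht := by
  induction t with
  | zero => rfl
  | succ t ih =>
    rw [Q.state_succ, ← flipUnitary_mulVec_oracle, Matrix.mulVec_mulVec, ← ih (by omega)]
    rfl

theorem prob_dual {d : ℕ} (Q : QAlg d) (y : Fin d → Bool) (b : Bool) :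
    Q.dual.prob y b = Q.prob (fun i => !(y i)) (!b) := by
  have h := Q.state_dual y Q.queries (Nat.lt_succ_self _)
  refine Finset.sum_congr rfl fun s _ => ?_
  rw [← h]
  change (if (!(Q.out s)) = b then _ else _) = _
  cases b <;> cases Q.out s <;> rfl

end QAlg

/-! ### Householder unitaries -/

/-- The reflection `1 - w w*` for a vector `w` with `⟨w, w⟩ = 2` (and `1` for other `w`). -/
noncomputable def householder {ι : Type*} [Fintype ι] [DecidableEq ι] (w : ι → ℂ) :
    Matrix.unitaryGroup ι ℂ :=
  open Classical in
  if h : star w ⬝ᵥ w = 2 then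
    ⟨1 - Matrix.vecMulVec w (star w), by
      rw [Matrix.mem_unitaryGroup_iff, Matrix.star_eq_conjTranspose, Matrix.conjTranspose_sub,
        Matrix.conjTranspose_one, Matrix.conjTranspose_vecMulVec, star_star, sub_mul, mul_sub,
        mul_sub, Matrix.vecMulVec_mul_vecMulVec, h, Matrix.vecMulVec_smul]
      simp only [one_mul, mul_one]
      module⟩
  else 1

theorem householder_mulVec {ι : Type*} [Fintype ι] [DecidableEq ι] {w : ι → ℂ}
    (h : star w ⬝ᵥ w = 2) (v : ι → ℂ) :
    (householder w : Matrix ι ι ℂ).mulVec v = v - (star w ⬝ᵥ v) • w := by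
  rw [householder, dif_pos h]
  simp [Matrix.sub_mulVec, Matrix.vecMulVec_mulVec]

/-- The reflection `2 S S* - 1` about the line of a unit vector `S`. -/
noncomputable def reflection {ι : Type*} [Fintype ι] [DecidableEq ι] (S : ι → ℂ) :
    Matrix.unitaryGroup ι ℂ :=
  -householder ((√2 : ℂ) • S)

theorem reflection_mulVec {ι : Type*} [Fintype ι] [DecidableEq ι] {S : ι → ℂ}
    (h : star S ⬝ᵥ S = 1) (v : ι → ℂ) :
    (reflection S : Matrix ι ι ℂ).mulVec v = (2 * (star S ⬝ᵥ v)) • S - v := by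
  have h2 : (√2 : ℂ) * (√2 : ℂ) = 2 := by
    rw [← Complex.ofReal_mul, Real.mul_self_sqrt (by norm_num)]; norm_num
  have hs : star ((√2 : ℂ) • S) = (√2 : ℂ) • star S := by
    rw [star_smul]; simp
  rw [reflection, Unitary.coe_neg, Matrix.neg_mulVec, householder_mulVec]
  · rw [hs, smul_dotProduct, smul_smul, smul_eq_mul, mul_right_comm, h2]
    module
  · rw [hs, smul_dotProduct, dotProduct_smul, h, smul_eq_mul, smul_eq_mul, mul_one, h2]

/-- The reflection that exchanges two orthogonal unit vectors. -/
noncomputable def exchange {ι : Type*} [Fintype ι] [DecidableEq ι] (S S' : ι → ℂ) :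
    Matrix.unitaryGroup ι ℂ :=
  householder (S - S')

theorem exchange_mulVec {ι : Type*} [Fintype ι] [DecidableEq ι] {S S' : ι → ℂ}
    (h : star S ⬝ᵥ S = 1) (h' : star S' ⬝ᵥ S' = 1) (ho : star S ⬝ᵥ S' = 0)
    (ho' : star S' ⬝ᵥ S = 0) (v : ι → ℂ) :
    (exchange S S' : Matrix ι ι ℂ).mulVec v =
      v - (star S ⬝ᵥ v - star S' ⬝ᵥ v) • (S - S') := by
  rw [exchange, householder_mulVec, star_sub, sub_dotProduct]
  rw [star_sub, sub_dotProduct, dotProduct_sub, dotProduct_sub, h, h', ho, ho']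
  norm_num

/-! ### The search states -/

/-- The amplitude `√(1 - a)` on the idle query, and total weight `a` spread evenly over the `d`
input positions. -/
noncomputable def searchAmp (d : ℕ) (a : ℝ) : Option (Fin d) → ℝ
  | none => √(1 - a)
  | some _ => √(a / d)

/-- The state `(√(1 - a) |none⟩ + √(a / d) ∑ᵢ |i⟩) ⊗ |-⟩ ⊗ |j⟩`, where `j` is a label in the
workspace. -/
noncomputable def searchState (d w : ℕ) (a : ℝ) (j : ℕ) : Reg d w → ℂ := fun s =>
  if s.2.2.1 = j then ((searchAmp d a s.1 * (if s.2.1 then -√(1 / 2) else √(1 / 2)) : ℝ) : ℂ) else 0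

/-- The number of ones of an input. -/
def onesCount {d : ℕ} (y : Fin d → Bool) : ℕ := (Finset.univ.filter fun i => y i = true).card

/-- Since the answer qubit is in the state `|-⟩`, the oracle acts on the search state by the signs
`(-1) ^ y i`. -/
theorem inner_searchState_oracle {d w : ℕ} (hd : 0 < d) {a : ℝ} (h0 : 0 ≤ a) (h1 : a ≤ 1) {j : ℕ}
    (hj : j < w) (y : Fin d → Bool) :
    star (searchState d w a j) ⬝ᵥ oracle y (searchState d w a j) =
      ((1 - 2 * a * onesCount y / d : ℝ) : ℂ) := by
  have e1 : √(1 - a) * √(1 - a) = 1 - a := Real.mul_self_sqrt (by linarith)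
  have e2 : √(a / d) * √(a / d) = a / d := Real.mul_self_sqrt (by positivity)
  have e3 : √(1 / 2 : ℝ) * √(1 / 2) = 1 / 2 := Real.mul_self_sqrt (by norm_num)
  have key : ∀ (o : Option (Fin d)) (b : Bool) (z : Fin w),
      star (searchState d w a j (o, b, z)) * oracle y (searchState d w a j) (o, b, z) =
      if z = ⟨j, hj⟩ then (((match o with
        | none => (1 - a) / 2
        | some i => if y i then -(a / d) / 2 else (a / d) / 2 : ℝ)) : ℂ) else 0 := by
    intro o b z
    by_cases hz : z = ⟨j, hj⟩
    · subst hz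
      rcases o with _ | i
      · simp only [oracle, searchState, searchAmp, if_true, RCLike.star_def, Complex.conj_ofReal,
          ← Complex.ofReal_mul, Complex.ofReal_inj]
        cases b <;> simp only [if_true, Bool.false_eq_true, if_false] <;>
          linear_combination √(1 / 2) * √(1 / 2) * e1 + (1 - a) * e3
      · simp only [oracle, searchState, searchAmp, if_true, RCLike.star_def, Complex.conj_ofReal,
          ← Complex.ofReal_mul, Complex.ofReal_inj]
        cases b <;> cases y i <;> simp only [Bool.xor_true, Bool.xor_false, Bool.not_true,
          Bool.not_false, if_true, Bool.false_eq_true, if_false]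
        · linear_combination √(1 / 2) * √(1 / 2) * e2 + (a / d) * e3
        · linear_combination -(√(1 / 2) * √(1 / 2) * e2 + (a / d) * e3)
        · linear_combination √(1 / 2) * √(1 / 2) * e2 + (a / d) * e3
        · linear_combination -(√(1 / 2) * √(1 / 2) * e2 + (a / d) * e3)
    · have hz' : z.1 ≠ j := fun h => hz (Fin.ext h)
      simp [searchState, hz, hz']
  have hsum : ∑ i : Fin d, (if y i then -(a / d) / 2 else (a / d) / 2 : ℝ) =
      a / 2 - a * onesCount y / d := by
    have hd' : (d : ℝ) ≠ 0 := by positivity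
    have : ∀ i, (if y i then -(a / d) / 2 else (a / d) / 2 : ℝ) =
        (a / d) / 2 - (a / d) * (if y i = true then 1 else 0) := by
      intro i
      split_ifs <;> ring
    simp only [this, Finset.sum_sub_distrib, ← Finset.mul_sum, Finset.sum_boole, onesCount]
    simp
    field_simp
  simp only [dotProduct, Pi.star_apply, Fintype.sum_prod_type, key, Finset.sum_ite_eq',
    Finset.mem_univ, if_true, Fintype.sum_bool, ← Complex.ofReal_sum]
  rw [Fintype.sum_option, Finset.sum_add_distrib, hsum]
  congr 1
  ring

theorem inner_searchState_self {d w : ℕ} (hd : 0 < d) {a : ℝ} (h0 : 0 ≤ a) (h1 : a ≤ 1) {j : ℕ}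
    (hj : j < w) : star (searchState d w a j) ⬝ᵥ searchState d w a j = 1 := by
  have h := inner_searchState_oracle hd h0 h1 hj (fun _ => false)
  rw [oracle_false] at h
  rw [h]
  simp [onesCount]

/-- The state vanishes at all labels `≥ j`. -/
def LabelsBelow {d w : ℕ} (j : ℕ) (ψ : Reg d w → ℂ) : Prop := ∀ s, j ≤ s.2.2.1 → ψ s = 0

namespace LabelsBelow

variable {d w : ℕ} {j : ℕ} {ψ φ : Reg d w → ℂ}

theorem add (h : LabelsBelow j ψ) (h' : LabelsBelow j φ) : LabelsBelow j (ψ + φ) := fun s hs => by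
  simp [h s hs, h' s hs]

theorem smul (h : LabelsBelow j ψ) (α : ℂ) : LabelsBelow j (α • ψ) := fun s hs => by
  simp [h s hs]

theorem neg (h : LabelsBelow j ψ) : LabelsBelow j (-ψ) := fun s hs => by
  simp [h s hs]

theorem mono (h : LabelsBelow j ψ) {j' : ℕ} (hj : j ≤ j') : LabelsBelow j' ψ :=
  fun s hs => h s (hj.trans hs)

theorem oracle (h : LabelsBelow j ψ) (y : Fin d → Bool) : LabelsBelow j (oracle y ψ) := by
  rintro ⟨_ | i, b, z⟩ hs <;> exact h _ hs

theorem searchState (a : ℝ) (j : ℕ) : LabelsBelow (j + 1) (searchState d w a j) := fun s hs => by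
  rw [_root_.searchState, if_neg (by omega)]

theorem inner_searchState (h : LabelsBelow j ψ) (a : ℝ) {j' : ℕ} (hj : j ≤ j') :
    star (_root_.searchState d w a j') ⬝ᵥ ψ = 0 := by
  refine Finset.sum_eq_zero fun s _ => ?_
  by_cases hs : s.2.2.1 = j'
  · rw [h s (by omega), mul_zero]
  · simp [_root_.searchState, hs]

end LabelsBelow

theorem inner_searchState_of_ne {d w : ℕ} (a a' : ℝ) {j j' : ℕ} (hj : j ≠ j') :
    star (searchState d w a j) ⬝ᵥ searchState d w a' j' = 0 := by
  refine Finset.sum_eq_zero fun s _ => ?_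
  by_cases hs : s.2.2.1 = j'
  · have : s.2.2.1 ≠ j := by omega
    simp [searchState, this]
  · simp [searchState, hs]

/-! ### One test -/

open Polynomial Chebyshev in
/-- After `n` rounds of Grover's iteration the component in the plane of the search state `S` and of
its image `O S` has coordinates given by Chebyshev polynomials of the second kind. -/
theorem run_replicate_reflection {d w : ℕ} (hd : 0 < d) {a : ℝ} (h0 : 0 ≤ a) (h1 : a ≤ 1) {j : ℕ}
    (hj : j < w) (y : Fin d → Bool) (α : ℂ) {r : Reg d w → ℂ} (hr : LabelsBelow j r) (n : ℕ) :
    ∃ r', LabelsBelow j r' ∧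
      QAlg.run y (List.replicate n (reflection (searchState d w a j)))
        (α • searchState d w a j + r) =
      α • ((((U ℝ n).eval (1 - 2 * a * onesCount y / d) : ℝ) : ℂ) • searchState d w a j -
        (((U ℝ (n - 1)).eval (1 - 2 * a * onesCount y / d) : ℝ) : ℂ) •
          oracle y (searchState d w a j)) + r' := by
  induction n with
  | zero => exact ⟨r, hr, by simp [QAlg.run]⟩
  | succ n ih =>
    obtain ⟨r', hr', e⟩ := ih
    set S := searchState d w a j with hS
    set u : ℝ := 1 - 2 * a * onesCount y / d with hu
    refine ⟨-oracle y r', (hr'.oracle y).neg, ?_⟩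
    rw [List.replicate_succ', QAlg.run_append, e]
    have hSS : star S ⬝ᵥ S = 1 := inner_searchState_self hd h0 h1 hj
    have hSO : star S ⬝ᵥ oracle y S = (u : ℂ) := inner_searchState_oracle hd h0 h1 hj y
    have hU : (U ℝ ((n + 1 : ℕ) : ℤ)).eval u =
        2 * u * (U ℝ n).eval u - (U ℝ (n - 1)).eval u := by
      have := U_add_two ℝ ((n : ℤ) - 1)
      rw [show (n : ℤ) - 1 + 2 = ((n + 1 : ℕ) : ℤ) by push_cast; ring,
        show (n : ℤ) - 1 + 1 = n by ring] at this
      rw [this]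
      simp
    simp only [QAlg.run]
    rw [reflection_mulVec hSS, oracle_add, oracle_smul, oracle_sub, oracle_smul,
      oracle_smul, oracle_oracle, dotProduct_add, dotProduct_smul,
      dotProduct_sub, dotProduct_smul, dotProduct_smul, hSS, hSO,
      (hr'.oracle y).inner_searchState a le_rfl, hU]
    simp only [smul_eq_mul, Nat.cast_add, Nat.cast_one, add_sub_cancel_right]
    push_cast
    module

/-- The unitaries of one test: `n` rounds of Grover's iteration, then a further query and the
exchange of the search state with the next search state, which has the next label. -/
noncomputable def testUnitaries {d w : ℕ} (S S' : Reg d w → ℂ) (n : ℕ) :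
    List (Matrix.unitaryGroup (Reg d w) ℂ) :=
  List.replicate n (reflection S) ++ [exchange S S']

open Polynomial Chebyshev in
/-- A test multiplies the amplitude of the current search state by a Chebyshev polynomial. All the
rest keeps a smaller label. -/
theorem run_testUnitaries {d w : ℕ} (hd : 0 < d) {a a' : ℝ} (h0 : 0 ≤ a) (h1 : a ≤ 1)
    (h0' : 0 ≤ a') (h1' : a' ≤ 1) {j : ℕ} (hj : j + 1 < w) (y : Fin d → Bool) (α : ℂ)
    {r : Reg d w → ℂ} (hr : LabelsBelow j r) (n : ℕ) :
    ∃ r', LabelsBelow (j + 1) r' ∧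
      QAlg.run y (testUnitaries (searchState d w a j) (searchState d w a' (j + 1)) n)
        (α • searchState d w a j + r) =
      (α * (((T ℝ (n + 1)).eval (1 - 2 * a * onesCount y / d) : ℝ) : ℂ)) •
        searchState d w a' (j + 1) + r' := by
  obtain ⟨r', hr', e⟩ := run_replicate_reflection hd h0 h1 (Nat.lt_of_succ_lt hj) y α hr n
  set S := searchState d w a j with hS
  set S' := searchState d w a' (j + 1) with hS'
  set u : ℝ := 1 - 2 * a * onesCount y / d with hu
  have hSS : star S ⬝ᵥ S = 1 := inner_searchState_self hd h0 h1 (Nat.lt_of_succ_lt hj)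
  have hSS' : star S' ⬝ᵥ S' = 1 := inner_searchState_self hd h0' h1' hj
  have ho : star S ⬝ᵥ S' = 0 := inner_searchState_of_ne _ _ (by omega)
  have ho' : star S' ⬝ᵥ S = 0 := inner_searchState_of_ne _ _ (by omega)
  have hSO : star S ⬝ᵥ oracle y S = (u : ℂ) :=
    inner_searchState_oracle hd h0 h1 (Nat.lt_of_succ_lt hj) y
  have hbS : LabelsBelow (j + 1) S := LabelsBelow.searchState a j
  have hSO' : star S' ⬝ᵥ oracle y S = 0 := (hbS.oracle y).inner_searchState a' le_rfl
  have hr1 : star S ⬝ᵥ oracle y r' = 0 := (hr'.oracle y).inner_searchState a le_rfl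
  have hr2 : star S' ⬝ᵥ oracle y r' = 0 := (hr'.oracle y).inner_searchState a' (Nat.le_succ j)
  have hT : (T ℝ (n + 1)).eval u = u * (U ℝ n).eval u - (U ℝ (n - 1)).eval u := by
    have h2 := U_add_two ℝ ((n : ℤ) - 1)
    rw [show (n : ℤ) - 1 + 2 = n + 1 by ring, show (n : ℤ) - 1 + 1 = n by ring] at h2
    rw [T_eq_U_sub_X_mul_U, h2, show (n : ℤ) + 1 - 1 = n by ring]
    simp
    ring
  set p : ℝ := (U ℝ n).eval u
  set q : ℝ := (U ℝ (n - 1)).eval u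
  refine ⟨(α * p) • oracle y S + (-(α * q) - α * (u * p - q)) • S + oracle y r',
    (((hbS.oracle y).smul _).add (hbS.smul _)).add ((hr'.mono (Nat.le_succ j)).oracle y), ?_⟩
  rw [testUnitaries, QAlg.run_append, e]
  simp only [QAlg.run]
  rw [exchange_mulVec hSS hSS' ho ho', oracle_add, oracle_smul, oracle_sub, oracle_smul,
      oracle_smul, oracle_oracle]
  simp only [dotProduct_add, dotProduct_sub, dotProduct_smul, hSS, hSO, ho', hSO', hr1, hr2, hT,
    smul_eq_mul]
  push_cast
  module

/-! ### A sequence of tests -/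

/-- The unitaries of the first `i` of a sequence of tests with parameters `a` and `n`. -/
noncomputable def searchUnitaries (d w : ℕ) (a : ℕ → ℝ) (n : ℕ → ℕ) :
    ℕ → List (Matrix.unitaryGroup (Reg d w) ℂ)
  | 0 => []
  | i + 1 => searchUnitaries d w a n i ++
      testUnitaries (searchState d w (a i) (i + 1)) (searchState d w (a (i + 1)) (i + 2)) (n i)

theorem length_searchUnitaries (d w : ℕ) (a : ℕ → ℝ) (n : ℕ → ℕ) (i : ℕ) :
    (searchUnitaries d w a n i).length = ∑ l ∈ Finset.range i, (n l + 1) := by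
  induction i with
  | zero => rfl
  | succ i ih =>
    rw [searchUnitaries, List.length_append, ih, Finset.sum_range_succ]
    simp [testUnitaries]

/-- The algorithm that makes `m` tests. It outputs `false` if it ends with the label that is
reached by passing through all search states. -/
noncomputable def searchAlg (d m : ℕ) (a : ℕ → ℝ) (n : ℕ → ℕ) : QAlg d :=
  QAlg.ofList (w := m + 2)
    (exchange (Pi.single (none, false, 0) 1) (searchState d (m + 2) (a 0) 1))
    (searchUnitaries d (m + 2) a n m) (none, false, 0) (fun s => decide (s.2.2.1 ≠ m + 1))

open Polynomial.Chebyshev in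
/-- The amplitudes of the tests multiply. -/
theorem prob_searchAlg_false {d : ℕ} (hd : 0 < d) (m : ℕ) {a : ℕ → ℝ} (h0 : ∀ i, 0 ≤ a i)
    (h1 : ∀ i, a i ≤ 1) (n : ℕ → ℕ) (y : Fin d → Bool) :
    (searchAlg d m a n).prob y false = ∏ i ∈ Finset.range m,
      (T ℝ (n i + 1)).eval (1 - 2 * a i * onesCount y / d) ^ 2 := by
  set e : Reg d (m + 2) → ℂ := Pi.single (none, false, 0) 1 with he
  have hstart : ((exchange e (searchState d (m + 2) (a 0) 1) :
      Matrix.unitaryGroup _ ℂ) : Matrix _ _ ℂ).mulVec e = searchState d (m + 2) (a 0) 1 := by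
    have hzero : searchState d (m + 2) (a 0) 1 (none, false, 0) = 0 := by simp [searchState]
    have hee : star e ⬝ᵥ e = 1 := by simp [he]
    have heS : star (searchState d (m + 2) (a 0) 1) ⬝ᵥ e = 0 := by simp [he, hzero]
    have hSe : star e ⬝ᵥ searchState d (m + 2) (a 0) 1 = 0 := by
      rw [he, Pi.star_single, star_one, single_one_dotProduct, hzero]
    rw [exchange_mulVec hee (inner_searchState_self hd (h0 0) (h1 0) (by omega)) hSe heS, hee, heS]
    simp
  have hrun : ∀ i ≤ m, ∃ r, LabelsBelow (i + 1) r ∧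
      QAlg.run y (searchUnitaries d (m + 2) a n i) (searchState d (m + 2) (a 0) 1) =
        ((∏ l ∈ Finset.range i, (T ℝ (n l + 1)).eval (1 - 2 * a l * onesCount y / d) : ℝ) : ℂ) •
          searchState d (m + 2) (a i) (i + 1) + r := by
    intro i
    induction i with
    | zero => exact fun _ => ⟨0, fun _ _ => rfl, by simp [searchUnitaries, QAlg.run]⟩
    | succ i ih =>
      intro hi
      obtain ⟨r, hr, h⟩ := ih (by omega)
      obtain ⟨r', hr', h'⟩ := run_testUnitaries (w := m + 2) hd (h0 i) (h1 i) (h0 (i + 1))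
        (h1 (i + 1)) (by omega) y _ hr (n i)
      refine ⟨r', hr', ?_⟩
      rw [searchUnitaries, QAlg.run_append, h, h', Finset.prod_range_succ, Complex.ofReal_mul]
  obtain ⟨r, hr, h⟩ := hrun m le_rfl
  rw [searchAlg, QAlg.prob_ofList, hstart, h, Finset.prod_pow]
  set A := ∏ l ∈ Finset.range m, (T ℝ (n l + 1)).eval (1 - 2 * a l * onesCount y / d)
  have hterm : ∀ s : Reg d (m + 2),
      (if decide (s.2.2.1 ≠ m + 1) = false then
        ‖((A : ℂ) • searchState d (m + 2) (a m) (m + 1) + r) s‖ ^ 2 else 0) =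
      A ^ 2 * ‖searchState d (m + 2) (a m) (m + 1) s‖ ^ 2 := by
    intro s
    by_cases hs : s.2.2.1 = m + 1
    · simp [hs, hr s hs.ge, mul_pow]
    · simp [hs, searchState]
  rw [Finset.sum_congr rfl fun s _ => hterm s, ← Finset.mul_sum]
  have hS := inner_searchState_self hd (h0 m) (h1 m) (show m + 1 < m + 2 by omega)
  rw [← ofReal_sum_norm_sq] at hS
  rw [Complex.ofReal_eq_one.1 hS, mul_one]

/-! ### The choice of the tests -/

theorem exists_queryAlg_of_tests {d : ℕ} (hd : 0 < d) {ι : Type*} [Fintype ι] (a : ι → ℝ)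
    (N : ι → ℕ) (h0 : ∀ i, 0 ≤ a i) (h1 : ∀ i, a i ≤ 1) (hN : ∀ i, 1 ≤ N i) :
    ∃ Q : QAlg d, Q.queries = ∑ i, N i ∧ ∀ y : Fin d → Bool, Q.prob y false =
      ∏ i, (Polynomial.Chebyshev.T ℝ (N i)).eval (1 - 2 * a i * onesCount y / d) ^ 2 := by
  let e := Fintype.equivFin ι
  let a' : ℕ → ℝ := fun l => if h : l < Fintype.card ι then a (e.symm ⟨l, h⟩) else 0
  let n' : ℕ → ℕ := fun l => if h : l < Fintype.card ι then N (e.symm ⟨l, h⟩) - 1 else 0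
  have ha : ∀ l : Fin (Fintype.card ι), a' l = a (e.symm l) := fun l => dif_pos l.2
  have hn : ∀ l : Fin (Fintype.card ι), n' l + 1 = N (e.symm l) := fun l => by
    have := hN (e.symm l)
    simp only [n', dif_pos l.2, Fin.eta]
    omega
  refine ⟨searchAlg d (Fintype.card ι) a' n', ?_, fun y => ?_⟩
  · refine (length_searchUnitaries _ _ _ _ _).trans ?_
    rw [Finset.sum_range, ← Equiv.sum_comp e.symm]
    exact Finset.sum_congr rfl fun l _ => hn l
  · rw [prob_searchAlg_false hd _ (fun l => ?_) (fun l => ?_), Finset.prod_range,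
      ← Equiv.prod_comp e.symm]
    · refine Finset.prod_congr rfl fun l _ => ?_
      rw [ha, ← hn l]
      push_cast
      rfl
    · by_cases h : l < Fintype.card ι <;> simp [a', h, h0]
    · by_cases h : l < Fintype.card ι <;> simp [a', h, h1]

/-- The weight of the input positions for which a test with `n` queries certainly detects
`t` ones among `d` bits. -/
noncomputable def testWeight (d : ℕ) (t : ℝ) (n : ℕ) : ℝ :=
  d * (1 - Real.cos (Real.pi / (2 * n))) / (2 * t)

/-- The number of queries of a test for `t` ones among `d` bits. -/
noncomputable def testQueries (d : ℕ) (t : ℝ) : ℕ := ⌈√(d / t)⌉₊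

theorem testWeight_nonneg (d : ℕ) {t : ℝ} (ht : 0 < t) (n : ℕ) : 0 ≤ testWeight d t n := by
  have := Real.cos_le_one (Real.pi / (2 * n))
  unfold testWeight
  apply div_nonneg _ (by positivity)
  exact mul_nonneg (by positivity) (by linarith)

theorem one_le_testQueries {d : ℕ} (hd : 0 < d) {t : ℝ} (ht : 0 < t) : 1 ≤ testQueries d t :=
  Nat.one_le_ceil_iff.2 (by positivity)

theorem testWeight_le_one {d : ℕ} (hd : 0 < d) {t : ℝ} (ht : 0 < t) :
    testWeight d t (testQueries d t) ≤ 1 := by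
  set n := testQueries d t with hn
  have hn1 : 1 ≤ n := one_le_testQueries hd ht
  have hn' : (0 : ℝ) < n := by exact_mod_cast hn1
  have h1 : √(d / t) ≤ n := Nat.le_ceil _
  have h2 : (d : ℝ) ≤ n ^ 2 * t := by
    rw [Real.sqrt_le_left hn'.le, div_le_iff₀ ht] at h1
    exact h1
  have h3 := Real.one_sub_sq_div_two_le_cos (x := Real.pi / (2 * n))
  have h4 : Real.pi ^ 2 ≤ 10 := by nlinarith [Real.pi_lt_d2, Real.pi_pos]
  have h5 : 1 - Real.cos (Real.pi / (2 * n)) ≤ 2 / n ^ 2 := by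
    have : (Real.pi / (2 * n)) ^ 2 / 2 = Real.pi ^ 2 / 8 / n ^ 2 := by field_simp; norm_num
    have h6 : Real.pi ^ 2 / 8 / n ^ 2 ≤ 2 / n ^ 2 := by gcongr; linarith
    linarith
  unfold testWeight
  rw [div_le_one (by positivity)]
  calc (d : ℝ) * (1 - Real.cos (Real.pi / (2 * n))) ≤ n ^ 2 * t * (2 / n ^ 2) := by
        have := Real.cos_le_one (Real.pi / (2 * n))
        gcongr
    _ = 2 * t := by field_simp

theorem testWeight_arg {d : ℕ} (hd : 0 < d) (t₀ t : ℝ) (n : ℕ) :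
    1 - 2 * testWeight d t₀ n * t / d = 1 - t / t₀ * (1 - Real.cos (Real.pi / (2 * n))) := by
  have : (d : ℝ) ≠ 0 := by positivity
  unfold testWeight
  congr 1
  rw [div_eq_iff this]
  ring

theorem eval_T_testWeight_eq_zero {d : ℕ} (hd : 0 < d) {t : ℝ} (ht : 0 < t) {n : ℕ} (hn : 1 ≤ n) :
    (Polynomial.Chebyshev.T ℝ n).eval (1 - 2 * testWeight d t n * t / d) = 0 := by
  have hn' : (n : ℝ) ≠ 0 := by positivity
  rw [testWeight_arg hd, div_self ht.ne', one_mul, sub_sub_cancel, Polynomial.Chebyshev.T_real_cos,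
    Int.cast_natCast, show (n : ℝ) * (Real.pi / (2 * n)) = Real.pi / 2 by field_simp,
    Real.cos_pi_div_two]

/-- A test for `t₀` ones still detects `t` ones with constant probability if `t₀ / 2 ≤ t ≤ t₀`. -/
theorem eval_T_testWeight_sq_le {d : ℕ} (hd : 0 < d) {t₀ t : ℝ} (ht₀ : 0 < t₀) {n : ℕ}
    (hn : 1 ≤ n) (h1 : t₀ ≤ 2 * t) (h2 : t ≤ t₀) :
    (Polynomial.Chebyshev.T ℝ n).eval (1 - 2 * testWeight d t₀ n * t / d) ^ 2 ≤ 4 / 5 := by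
  have hn' : (1 : ℝ) ≤ n := by exact_mod_cast hn
  have hn0 : (0 : ℝ) < n := by linarith
  have hpi := Real.pi_pos
  have hpi2 : Real.pi ^ 2 ≤ 10 := by nlinarith [Real.pi_lt_d2]
  set x := Real.pi / (2 * n) with hx
  have hx0 : 0 < x := by positivity
  have hnx : n * x = Real.pi / 2 := by rw [hx]; field_simp
  have hxpi : x ≤ Real.pi / 2 := by nlinarith
  have hc0 : 0 ≤ Real.cos x := Real.cos_nonneg_of_mem_Icc ⟨by linarith, hxpi⟩
  have hc1 := Real.cos_le_one x
  have hl1 : t / t₀ ≤ 1 := (div_le_one ht₀).2 h2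
  have hl2 : 1 / 2 ≤ t / t₀ := by rw [div_le_div_iff₀ (by norm_num) ht₀]; linarith
  rw [testWeight_arg hd]
  set u := 1 - t / t₀ * (1 - Real.cos x) with hu
  have hu1 : u ≤ 1 := by nlinarith
  have huc : Real.cos x ≤ u := by nlinarith
  set φ := Real.arccos u with hφ
  have hcos : Real.cos φ = u := Real.cos_arccos (by linarith) hu1
  have hφ0 : 0 ≤ φ := Real.arccos_nonneg u
  have hφx : φ ≤ x := by
    rw [← Real.arccos_cos hx0.le (by linarith)]
    exact Real.antitone_arccos huc
  have hnφ : n * φ ≤ Real.pi / 2 := hnx ▸ mul_le_mul_of_nonneg_left hφx hn0.le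
  have hq := Real.cos_le_one_sub_mul_cos_sq (x := x) (by rw [abs_of_pos hx0]; linarith)
  have hφq := Real.one_sub_sq_div_two_le_cos (x := φ)
  have hlow : 1 / 2 ≤ (n * φ) ^ 2 := by
    have e1 : 2 / Real.pi ^ 2 * x ^ 2 = 1 / (2 * n ^ 2) := by rw [hx]; field_simp
    rw [e1] at hq
    have e2 : 1 / (4 * (n : ℝ) ^ 2) ≤ φ ^ 2 / 2 := by
      have : 1 / (4 * (n : ℝ) ^ 2) = 1 / 2 * (1 / (2 * n ^ 2)) := by field_simp; norm_num
      nlinarith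
    rw [div_le_div_iff₀ (by positivity) (by norm_num)] at e2
    nlinarith
  have hsin : 2 / Real.pi * (n * φ) ≤ Real.sin (n * φ) := Real.mul_le_sin (by positivity) hnφ
  have hsin2 : 1 / 5 ≤ Real.sin (n * φ) ^ 2 := by
    have e3 : (2 / Real.pi * (n * φ)) ^ 2 ≤ Real.sin (n * φ) ^ 2 :=
      pow_le_pow_left₀ (by positivity) hsin 2
    have e4 : (1 / 5 : ℝ) ≤ (2 / Real.pi * (n * φ)) ^ 2 := by
      rw [mul_pow, div_pow, div_mul_eq_mul_div, le_div_iff₀ (by positivity)]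
      nlinarith
    linarith
  rw [← hcos, Polynomial.Chebyshev.T_real_cos, Int.cast_natCast]
  nlinarith [Real.sin_sq_add_cos_sq (n * φ)]

theorem eval_T_sq_le_one {u : ℝ} (h : -1 ≤ u) (h' : u ≤ 1) (n : ℤ) :
    (Polynomial.Chebyshev.T ℝ n).eval u ^ 2 ≤ 1 := by
  rw [← Real.cos_arccos h h', Polynomial.Chebyshev.T_real_cos]
  exact Real.cos_sq_le_one _

theorem sum_inv_sqrt_le (K : ℕ) : ∑ l ∈ Finset.range K, 1 / √((l : ℝ) + 1) ≤ 2 * √K := by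
  induction K with
  | zero => simp
  | succ K ih =>
    rw [Finset.sum_range_succ, Nat.cast_succ]
    have h1 : 0 < √((K : ℝ) + 1) := by positivity
    have h2 := Real.sq_sqrt (show (0 : ℝ) ≤ (K : ℝ) + 1 by positivity)
    have h3 := Real.sq_sqrt (show (0 : ℝ) ≤ (K : ℝ) by positivity)
    have h4 : 1 / √((K : ℝ) + 1) ≤ 2 * √((K : ℝ) + 1) - 2 * √(K : ℝ) := by
      rw [div_le_iff₀ h1]
      nlinarith [sq_nonneg (√((K : ℝ) + 1) - √(K : ℝ))]
    linarith

theorem sum_sqrt_geom_le (I : ℕ) : ∑ i ∈ Finset.range I, √(1 / 2 ^ i : ℝ) ≤ 4 := by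
  have h0 : (0 : ℝ) ≤ √(1 / 2) := Real.sqrt_nonneg _
  have h1 : √(1 / 2 : ℝ) ≤ 3 / 4 := by
    rw [Real.sqrt_le_left (by norm_num)]; norm_num
  have h2 : ∀ i : ℕ, √(1 / 2 ^ i : ℝ) = √(1 / 2) ^ i := fun i => by
    rw [← one_div_pow]
    induction i with
    | zero => simp
    | succ i ih => rw [pow_succ, Real.sqrt_mul (by positivity), ih, pow_succ]
  simp only [h2]
  have h3 := geom_sum_mul √(1 / 2 : ℝ) I
  have h4 : 0 ≤ ∑ i ∈ Finset.range I, √(1 / 2 : ℝ) ^ i := Finset.sum_nonneg fun i _ => by positivity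
  have h5 : 0 ≤ √(1 / 2 : ℝ) ^ I := by positivity
  nlinarith

theorem testQueries_le {d : ℕ} {t s : ℝ} (hs : 0 < s) (hst : s ≤ t) (hsd : s ≤ d) :
    (testQueries d t : ℝ) ≤ 2 * √(d / s) := by
  have h1 : (testQueries d t : ℝ) < √(d / t) + 1 := Nat.ceil_lt_add_one (by positivity)
  have h2 : √((d : ℝ) / t) ≤ √(d / s) := by gcongr
  have h3 : 1 ≤ √((d : ℝ) / s) := by
    rw [Real.one_le_sqrt, one_le_div hs]; exact hsd
  linarith

theorem gate_or_fn_eq_false_iff {d : ℕ} (y : Fin d → Bool) :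
    Gate.or.fn y = false ↔ onesCount y = 0 := by
  simp [Gate.fn, onesCount, Finset.filter_eq_empty_iff]

theorem onesCount_le {d : ℕ} (y : Fin d → Bool) : onesCount y ≤ d :=
  (Finset.card_filter_le _ _).trans (by simp)

/-- A boosted search: exact tests for each of the numbers `1, …, min k d` of ones, and `4 k` tests
for each of the numbers `min k d * 2 ^ (i + 1)` below `2 d`. -/
theorem exists_boosted_or {k d : ℕ} (hk : 1 ≤ k) (hd : 1 ≤ d) :
    ∃ Q : QAlg d, (Q.queries : ℝ) ≤ 36 * √(k * d) ∧
      ∀ y : Fin d → Bool, Q.prob y (!(Gate.or.fn y)) ≤ 1 / 2 ^ k := by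
  set K := min k d with hK
  have hK1 : 1 ≤ K := le_min hk hd
  have hKr : (0 : ℝ) < K := by exact_mod_cast hK1
  obtain ⟨I, hI, hI'⟩ : ∃ I, d ≤ K * 2 ^ I ∧ ∀ i < I, K * 2 ^ i < d := by
    have hex : ∃ I, d ≤ K * 2 ^ I :=
      ⟨d, Nat.lt_two_pow_self.le.trans (Nat.le_mul_of_pos_left _ hK1)⟩
    exact ⟨Nat.find hex, Nat.find_spec hex, fun i hi => not_le.1 (Nat.find_min hex hi)⟩
  let τ : Fin K ⊕ Fin I × Fin (4 * k) → ℝ :=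
    Sum.elim (fun l => (l : ℝ) + 1) (fun p => K * 2 ^ ((p.1 : ℕ) + 1))
  have hτ : ∀ i, 0 < τ i := by
    rintro (l | p) <;> simp only [τ, Sum.elim_inl, Sum.elim_inr] <;> positivity
  obtain ⟨Q, hQ, hP⟩ := exists_queryAlg_of_tests (d := d) hd
    (fun i => testWeight d (τ i) (testQueries d (τ i))) (fun i => testQueries d (τ i))
    (fun i => testWeight_nonneg d (hτ i) _) (fun i => testWeight_le_one hd (hτ i))
    (fun i => one_le_testQueries hd (hτ i))
  refine ⟨Q, ?_, fun y => ?_⟩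
  · have hz : (∑ l : Fin K, (testQueries d ((l : ℝ) + 1) : ℝ)) ≤ 4 * √(k * d) := by
      have e1 : ∀ l : Fin K, (testQueries d ((l : ℝ) + 1) : ℝ) ≤
          2 * √d * (1 / √((l : ℝ) + 1)) := fun l => by
        have hl : (l : ℕ) + 1 ≤ d := by
          have := l.2
          have : K ≤ d := min_le_right _ _
          omega
        refine (testQueries_le (s := (l : ℝ) + 1) (by positivity) le_rfl
          (by exact_mod_cast hl)).trans_eq ?_
        rw [Real.sqrt_div (by positivity)]
        ring
      calc (∑ l : Fin K, (testQueries d ((l : ℝ) + 1) : ℝ))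
          ≤ ∑ l : Fin K, 2 * √d * (1 / √((l : ℝ) + 1)) := Finset.sum_le_sum fun l _ => e1 l
        _ = 2 * √d * ∑ l ∈ Finset.range K, 1 / √((l : ℝ) + 1) := by
          rw [Finset.mul_sum, Finset.sum_range]
        _ ≤ 2 * √d * (2 * √k) := by
          have hKk : (K : ℝ) ≤ k := by exact_mod_cast min_le_left k d
          refine mul_le_mul_of_nonneg_left ((sum_inv_sqrt_le K).trans ?_) (by positivity)
          gcongr
        _ = 4 * √(k * d) := by
          rw [Real.sqrt_mul (by positivity)]; ring
    have hg : (∑ i : Fin I, (4 * k : ℝ) * (testQueries d (K * 2 ^ ((i : ℕ) + 1)) : ℝ)) ≤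
        32 * √(k * d) := by
      rcases Nat.eq_zero_or_pos I with rfl | hIpos
      · simp only [Finset.univ_eq_empty, Finset.sum_empty]
        positivity
      -- If there are tests of this kind at all, then `k < d`.
      have hKk : K = k := by
        have := hI' 0 hIpos
        simp only [pow_zero, mul_one] at this
        omega
      have e1 : ∀ i : Fin I, (4 * k : ℝ) * (testQueries d (K * 2 ^ ((i : ℕ) + 1)) : ℝ) ≤
          8 * √(k * d) * √(1 / 2 ^ (i : ℕ)) := fun i => by
        have h := testQueries_le (d := d) (t := K * 2 ^ ((i : ℕ) + 1)) (s := K * 2 ^ (i : ℕ))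
          (by positivity) (by gcongr <;> simp) (by exact_mod_cast (hI' i i.2).le)
        have e2 : √((d : ℝ) / (K * 2 ^ (i : ℕ))) = √(k * d) / k * √(1 / 2 ^ (i : ℕ)) := by
          rw [hKk] at hKr ⊢
          rw [Real.sqrt_eq_iff_eq_sq (by positivity) (by positivity), mul_pow, div_pow,
            Real.sq_sqrt (by positivity), Real.sq_sqrt (by positivity)]
          field_simp
        rw [e2] at h
        rw [hKk] at hKr h ⊢
        calc (4 * k : ℝ) * (testQueries d (k * 2 ^ ((i : ℕ) + 1)) : ℝ)
            ≤ 4 * k * (2 * (√(k * d) / k * √(1 / 2 ^ (i : ℕ)))) := by gcongr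
          _ = 8 * √(k * d) * √(1 / 2 ^ (i : ℕ)) := by field_simp; norm_num
      calc _ ≤ ∑ i : Fin I, 8 * √(k * d) * √(1 / 2 ^ (i : ℕ)) :=
            Finset.sum_le_sum fun i _ => e1 i
        _ = 8 * √(k * d) * ∑ i ∈ Finset.range I, √(1 / 2 ^ i) := by
          rw [Finset.mul_sum, Finset.sum_range]
        _ ≤ 8 * √(k * d) * 4 := by gcongr; exact sum_sqrt_geom_le I
        _ = 32 * √(k * d) := by ring
    rw [hQ, Nat.cast_sum, Fintype.sum_sum_type, Fintype.sum_prod_type]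
    simp only [τ, Sum.elim_inl, Sum.elim_inr, Finset.sum_const, Finset.card_univ, Fintype.card_fin,
      nsmul_eq_mul, Nat.cast_mul, Nat.cast_ofNat]
    linarith
  · rcases Nat.eq_zero_or_pos (onesCount y) with h0 | hpos
    · have h1 := Q.prob_add_prob_not y false
      have h2 : Q.prob y false = 1 := by
        rw [hP, h0]
        exact Finset.prod_eq_one fun i _ => by simp
      rw [(gate_or_fn_eq_false_iff y).2 h0]
      have h3 : Q.prob y (!false) = 0 := by linarith
      rw [h3]
      positivity
    · have hor : Gate.or.fn y = true := by
        rw [← Bool.not_eq_false, gate_or_fn_eq_false_iff]; omega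
      rw [hor, Bool.not_true, hP, Fintype.prod_sum_type]
      have hd' : (0 : ℝ) < d := by exact_mod_cast hd
      have hle1 : ∀ i, (Polynomial.Chebyshev.T ℝ (testQueries d (τ i))).eval
          (1 - 2 * testWeight d (τ i) (testQueries d (τ i)) * onesCount y / d) ^ 2 ≤ 1 := by
        intro i
        have hw0 := testWeight_nonneg d (hτ i) (testQueries d (τ i))
        have hw1 := testWeight_le_one hd (hτ i)
        have hc : (onesCount y : ℝ) / d ≤ 1 := by
          rw [div_le_one hd']; exact_mod_cast onesCount_le y
        have hc0 : 0 ≤ (onesCount y : ℝ) / d := by positivity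
        apply eval_T_sq_le_one <;> rw [mul_div_assoc] <;> nlinarith
      by_cases hle : onesCount y ≤ K
      · -- One of the exact tests detects the ones.
        rw [Finset.prod_eq_zero (Finset.mem_univ (⟨onesCount y - 1, by omega⟩ : Fin K)), zero_mul]
        · positivity
        · have : τ (Sum.inl ⟨onesCount y - 1, by omega⟩) = onesCount y := by
            simp only [τ, Sum.elim_inl]
            rw [← Nat.cast_succ, Nat.succ_eq_add_one, Nat.sub_add_cancel hpos]
          rw [this, eval_T_testWeight_eq_zero hd (by exact_mod_cast hpos)
            (one_le_testQueries hd (by exact_mod_cast hpos))]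
          norm_num
      · obtain ⟨i, hi, hlow, hup⟩ : ∃ i < I, K * 2 ^ i < onesCount y ∧
            onesCount y ≤ K * 2 ^ (i + 1) := by
          have hex : ∃ i, onesCount y ≤ K * 2 ^ i := ⟨I, (onesCount_le y).trans hI⟩
          have hfI : Nat.find hex ≤ I := Nat.find_min' hex ((onesCount_le y).trans hI)
          have hf0 : Nat.find hex ≠ 0 := fun h => by
            have := Nat.find_spec hex
            rw [h] at this
            omega
          refine ⟨Nat.find hex - 1, by omega, not_le.1 (Nat.find_min hex (by omega)), ?_⟩
          rw [Nat.sub_add_cancel (Nat.pos_of_ne_zero hf0)]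
          exact Nat.find_spec hex
        have hup' : (onesCount y : ℝ) ≤ K * 2 ^ (i + 1) := by exact_mod_cast hup
        have hlow' : (K : ℝ) * 2 ^ i ≤ onesCount y := by exact_mod_cast hlow.le
        have hpos0 : (0 : ℝ) < K * 2 ^ (i + 1) := by positivity
        have htest : (Polynomial.Chebyshev.T ℝ (testQueries d (K * 2 ^ (i + 1)))).eval
            (1 - 2 * testWeight d (K * 2 ^ (i + 1)) (testQueries d (K * 2 ^ (i + 1))) *
              onesCount y / d) ^ 2 ≤ 4 / 5 :=
          eval_T_testWeight_sq_le hd hpos0 (one_le_testQueries hd hpos0)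
            (by rw [pow_succ]; linarith) hup'
        have hkK : (4 / 5 : ℝ) ^ (4 * k) ≤ 1 / 2 ^ k := by
          rw [pow_mul, ← one_div_pow]
          gcongr
          norm_num
        refine le_trans ?_ hkK
        rw [Fintype.prod_prod_type]
        refine (mul_le_of_le_one_left (Finset.prod_nonneg fun _ _ => Finset.prod_nonneg fun _ _ =>
          sq_nonneg _) (Finset.prod_le_one (fun _ _ => sq_nonneg _) fun _ _ => hle1 _)).trans ?_
        rw [← Finset.mul_prod_erase _ _ (Finset.mem_univ (⟨i, hi⟩ : Fin I))]
        refine (mul_le_of_le_one_right (Finset.prod_nonneg fun _ _ => sq_nonneg _)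
          (Finset.prod_le_one (fun _ _ => Finset.prod_nonneg fun _ _ => sq_nonneg _) fun _ _ =>
            Finset.prod_le_one (fun _ _ => sq_nonneg _) fun _ _ => hle1 _)).trans ?_
        simp only [τ, Sum.elim_inr, Finset.prod_const, Finset.card_univ, Fintype.card_fin]
        exact pow_le_pow_left₀ (sq_nonneg _) htest _

theorem gate_and_fn_eq {d : ℕ} (y : Fin d → Bool) :
    Gate.and.fn y = !(Gate.or.fn fun i => !(y i)) := by
  rw [Bool.eq_iff_iff]
  simp [Gate.fn]

/-- The algorithms for AND are the duals of those for OR, by De Morgan's law. -/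
theorem exists_boosted : ∃ Q : GateAlgs, Q.IsBoosted 36 := by
  have h : ∀ (g : Gate) (k d : ℕ), ∃ Q : QAlg d, g = Gate.and ∨ g = Gate.or → 1 ≤ k → 1 ≤ d →
      (Q.queries : ℝ) ≤ 36 * √(k * d) ∧
        ∀ y : Fin d → Bool, Q.prob y (!(g.fn y)) ≤ 36 / 2 ^ k := by
    intro g k d
    by_cases hkd : 1 ≤ k ∧ 1 ≤ d
    · obtain ⟨Q, hq, hp⟩ := exists_boosted_or hkd.1 hkd.2
      have hc : (1 : ℝ) / 2 ^ k ≤ 36 / 2 ^ k := by gcongr; norm_num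
      cases g with
      | or => exact ⟨Q, fun _ _ _ => ⟨hq, fun y => (hp y).trans hc⟩⟩
      | and =>
        refine ⟨Q.dual, fun _ _ _ => ⟨hq, fun y => ?_⟩⟩
        rw [QAlg.prob_dual, Bool.not_not, gate_and_fn_eq]
        exact (hp _).trans hc
      | xor => exact ⟨Q, fun hg => by simp at hg⟩
    · exact ⟨searchAlg d 0 0 0, fun _ hk hd => absurd ⟨hk, hd⟩ hkd⟩
  choose Q hQ using h
  exact ⟨Q, fun g hg k d hk hd => hQ g k d hg hk hd⟩

/-! ### Values of gates and the replacement of XOR gates -/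

theorem gate_xor_fn_two {d : ℕ} (h : d = 2) (y : Fin d → Bool) :
    Gate.xor.fn y = Bool.xor (y ⟨0, by omega⟩) (y ⟨1, by omega⟩) := by
  subst h
  have : ∀ a b : Bool, Gate.xor.fn ![a, b] = Bool.xor a b := by decide
  have hy : y = ![y 0, y 1] := by funext i; fin_cases i <;> rfl
  rw [hy, this]
  rfl

theorem gate_and_fn_two {d : ℕ} (h : d = 2) (y : Fin d → Bool) :
    Gate.and.fn y = (y ⟨0, by omega⟩ && y ⟨1, by omega⟩) := by
  subst h
  rw [Bool.eq_iff_iff]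
  simp [Gate.fn, Fin.forall_fin_two]

theorem gate_or_fn_two {d : ℕ} (h : d = 2) (y : Fin d → Bool) :
    Gate.or.fn y = (y ⟨0, by omega⟩ || y ⟨1, by omega⟩) := by
  subst h
  rw [Bool.eq_iff_iff]
  simp [Gate.fn, Fin.exists_fin_two]

theorem lit_lit_false (σ b : Bool) : lit (lit false σ) b = !(lit σ b) := by
  cases σ <;> cases b <;> rfl

namespace GateDag

theorem isAndOrNot_replaceXor {I S : Type} [LinearOrder I] {N : ℕ} (G : GateDag I S N)
    (hG : G.IsXorAnd) : G.replaceXor.IsAndOrNot := by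
  intro p
  simp only [replaceXor]
  split_ifs with h h'
  · exact Or.inr rfl
  · exact Or.inl rfl
  · exact Or.inl ((hG _).resolve_right fun h'' => h h''.1)

theorem base_role_injective {I S : Type} [LinearOrder I] {N : ℕ} (G : GateDag I S N) :
    Function.Injective fun p : G.NewInner => (G.base p, G.role p) :=
  fun _ _ h => Subtype.ext (congrArg toLex h)

variable {I S : Type} [LinearOrder I] [Fintype I] {N : ℕ} (G : GateDag I S N) (x : Fin N → Bool)

/-- The value of a vertex: of a function-vertex or of a sink. -/
def vertexValue : I ⊕ S → Bool := Sum.elim (G.innerValue x) fun s => x (G.var s)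

/-- The value of the `k`-th argument of the vertex `i`. -/
def argValue (i : I) (k : Fin (G.deg i)) : Bool := lit (G.sign i k) (G.vertexValue x (G.nbr i k))

theorem innerValue_eq (i : I) : G.innerValue x i = (G.gate i).fn (G.argValue x i) := by
  rw [innerValue]
  congr 1
  funext k
  unfold argValue vertexValue
  cases G.nbr i k <;> rfl

theorem innerValue_of_xor {i : I} (hi : G.gate i = Gate.xor) (hd : G.deg i = 2) :
    G.innerValue x i = Bool.xor (G.argValue x i ⟨0, by omega⟩) (G.argValue x i ⟨1, by omega⟩) := by
  rw [innerValue_eq, hi, gate_xor_fn_two hd]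

theorem vertexValue_map_main {i : I}
    (h : ∀ j, i < j → G.replaceXor.innerValue x (G.main j) = G.innerValue x j)
    (k : Fin (G.deg i)) :
    G.replaceXor.vertexValue x (Sum.map G.main id (G.nbr i k)) = G.vertexValue x (G.nbr i k) := by
  cases hn : G.nbr i k with
  | inl j => exact h j (G.lt_of_nbr i k j hn)
  | inr s => rfl

theorem argValue_replaceXor_of_ne_xor {i : I} (hi : G.gate i ≠ Gate.xor)
    (h : ∀ j, i < j → G.replaceXor.innerValue x (G.main j) = G.innerValue x j)
    (k : Fin (G.replaceXor.deg (G.main i))) :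
    G.replaceXor.argValue x (G.main i) k =
      G.argValue x i ⟨k.1, k.2.trans_le (G.newDeg_le (G.main i))⟩ := by
  have hn : G.replaceXor.nbr (G.main i) k =
      Sum.map G.main id (G.nbr i ⟨k.1, k.2.trans_le (G.newDeg_le (G.main i))⟩) :=
    dif_neg fun h => hi h.1
  have hs : G.replaceXor.sign (G.main i) k =
      G.sign i ⟨k.1, k.2.trans_le (G.newDeg_le (G.main i))⟩ := if_neg hi
  rw [argValue, hn, hs, vertexValue_map_main G x h, argValue]

theorem argValue_replaceXor_andVertex {i : I} (hi : G.gate i = Gate.xor)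
    (h : ∀ j, i < j → G.replaceXor.innerValue x (G.main j) = G.innerValue x j) (l : Fin 2)
    (k : Fin (G.replaceXor.deg (G.andVertex i hi l))) :
    G.replaceXor.argValue x (G.andVertex i hi l) k = lit (decide (k.1 = l.1))
      (G.argValue x i ⟨k.1, k.2.trans_le (G.newDeg_le (G.andVertex i hi l))⟩) := by
  have hn : G.replaceXor.nbr (G.andVertex i hi l) k = Sum.map G.main id
      (G.nbr i ⟨k.1, k.2.trans_le (G.newDeg_le (G.andVertex i hi l))⟩) :=
    dif_neg fun h => Fin.succ_ne_zero l h.2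
  have hs : G.replaceXor.sign (G.andVertex i hi l) k = lit (decide (k.1 + 1 = l.1 + 1))
      (G.sign i ⟨k.1, k.2.trans_le (G.newDeg_le (G.andVertex i hi l))⟩) :=
    (if_pos hi).trans (if_neg (Fin.succ_ne_zero l))
  rw [argValue, hn, hs, vertexValue_map_main G x h, argValue]
  simp only [Nat.add_right_cancel_iff]
  by_cases hkl : k.1 = l.1
  · simp [hkl, lit]
  · simp only [hkl, decide_false, lit_lit_false]
    rfl

theorem innerValue_replaceXor_andVertex {i : I} (hi : G.gate i = Gate.xor) (hd : G.deg i = 2)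
    (h : ∀ j, i < j → G.replaceXor.innerValue x (G.main j) = G.innerValue x j) (l : Fin 2) :
    G.replaceXor.innerValue x (G.andVertex i hi l) =
      (lit (decide (0 = l.1)) (G.argValue x i ⟨0, by omega⟩) &&
        lit (decide (1 = l.1)) (G.argValue x i ⟨1, by omega⟩)) := by
  have hg : G.replaceXor.gate (G.andVertex i hi l) = Gate.and :=
    (if_pos hi).trans (if_neg (Fin.succ_ne_zero l))
  have hd' : G.replaceXor.deg (G.andVertex i hi l) = 2 := if_pos hi
  rw [innerValue_eq, hg, gate_and_fn_two hd', argValue_replaceXor_andVertex G x hi h,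
    argValue_replaceXor_andVertex G x hi h]

/-- The replacement does not change the values of the old vertices. -/
theorem innerValue_replaceXor_main (hG : G.IsXorAnd) (i : I) :
    G.replaceXor.innerValue x (G.main i) = G.innerValue x i := by
  induction i using (wellFounded_gt (α := I)).induction with
  | _ i ih =>
  rcases hG i with hi | ⟨hi, hd⟩
  · have hne : G.gate i ≠ Gate.xor := by rw [hi]; decide
    have hg : G.replaceXor.gate (G.main i) = Gate.and := (if_neg hne).trans hi
    have hd : G.newDeg (G.main i) = G.deg i := if_neg hne
    rw [innerValue_eq, innerValue_eq, hg, hi]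
    unfold Gate.fn
    simp only [decide_eq_decide]
    constructor
    · intro h k
      have hk : k.1 < G.replaceXor.deg (G.main i) := k.2.trans_eq hd.symm
      rw [← h ⟨k.1, hk⟩, argValue_replaceXor_of_ne_xor G x hne ih]
    · intro h k
      rw [argValue_replaceXor_of_ne_xor G x hne ih]
      exact h _
  · have hg : G.replaceXor.gate (G.main i) = Gate.or := (if_pos hi).trans (if_pos rfl)
    have hd' : G.replaceXor.deg (G.main i) = 2 := if_pos hi
    have harg : ∀ l : Fin 2, ∀ h : l.1 < G.replaceXor.deg (G.main i),
        G.replaceXor.argValue x (G.main i) ⟨l, h⟩ =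
          G.replaceXor.innerValue x (G.andVertex i hi l) := by
      intro l h
      have hn : G.replaceXor.nbr (G.main i) ⟨l, h⟩ = Sum.inl (G.andVertex i hi l) :=
        dif_pos ⟨hi, rfl⟩
      have hs : G.replaceXor.sign (G.main i) ⟨l, h⟩ = true := (if_pos hi).trans (if_pos rfl)
      rw [argValue, hn, hs]
      rfl
    rw [innerValue_eq, hg, gate_or_fn_two hd', G.innerValue_of_xor x hi hd]
    have h0 := harg 0 (by rw [hd']; decide)
    have h1 := harg 1 (by rw [hd']; decide)
    rw [innerValue_replaceXor_andVertex G x hi hd ih] at h0 h1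
    refine (congrArg₂ or h0 h1).trans ?_
    cases G.argValue x i ⟨0, by omega⟩ <;> cases G.argValue x i ⟨1, by omega⟩ <;> rfl

theorem value_replaceXor (hG : G.IsXorAnd) : G.replaceXor.value x = G.value x :=
  G.innerValue_replaceXor_main x hG G.root

theorem card_newInner_le : Fintype.card G.NewInner ≤ 3 * Fintype.card I := by
  have h := Fintype.card_le_of_injective _ G.base_role_injective
  rw [Fintype.card_prod, Fintype.card_fin] at h
  omega

theorem edgeCount_replaceXor_le : G.replaceXor.edgeCount ≤ 3 * G.edgeCount := by
  classical
  calc ∑ p, G.newDeg p ≤ ∑ p : G.NewInner, G.deg (G.base p) :=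
        Finset.sum_le_sum fun p _ => G.newDeg_le p
    _ = ∑ q ∈ Finset.univ.image (fun p : G.NewInner => (G.base p, G.role p)), G.deg q.1 :=
        (Finset.sum_image (f := fun q : I × Fin 3 => G.deg q.1)
          fun p _ q _ h => G.base_role_injective h).symm
    _ ≤ ∑ q : I × Fin 3, G.deg q.1 :=
        Finset.sum_le_sum_of_subset (Finset.subset_univ _)
    _ = 3 * ∑ i, G.deg i := by
        rw [Fintype.sum_prod_type, Finset.mul_sum]
        simp

end GateDag

/-! ### The cost and the values of the procedures that compute arguments -/

namespace Probe

theorem eval_neg {I S : Type} (X : Query I S → Answer I S) (p : Probe I S) :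
    p.neg.eval X = !(p.eval X) := by
  induction p with
  | ret b => rfl
  | ask q next ih => exact ih _

theorem cost_neg {I S : Type} (X : Query I S → Answer I S) (p : Probe I S) :
    p.neg.cost X = p.cost X := by
  induction p with
  | ret b => rfl
  | ask q next ih => exact congrArg (1 + ·) (ih _)

end Probe

section

variable {I S : Type} [LinearOrder I] {N : ℕ} (G : GateDag I S N) (x : Fin N → Bool)

theorem cost_memProbe (μ : Cell I → Bool) (c : Cell I) :
    (memProbe c : Probe I S).cost (blackBox G x μ) = 1 := rfl

theorem cost_argProbe_le (μ : Cell I → Bool) (i : I) (k : ℕ) :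
    (argProbe i k : Probe I S).cost (blackBox G x μ) ≤ 2 := by
  by_cases h : k < G.deg i
  · simp only [argProbe, Probe.cost, blackBox, h, dif_pos]
    cases G.nbr i ⟨k, h⟩ <;> simp [vertexProbe, Probe.cost, blackBox]
  · simp [argProbe, Probe.cost, blackBox, h]

theorem eval_argProbe [Fintype I] {μ : Cell I → Bool} {i : I}
    (hμ : ∀ j, i < j → μ (j, 0) = G.innerValue x j) (k : Fin (G.deg i)) :
    (argProbe i k : Probe I S).eval (blackBox G x μ) = G.argValue x i k := by
  simp only [argProbe, Probe.eval, blackBox, k.2, dif_pos, GateDag.argValue]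
  cases hn : G.nbr i k with
  | inl j => exact congrArg _ (hμ j (G.lt_of_nbr i k j hn))
  | inr s => rfl

/-! ### The error probability -/

theorem Prog.prob_nonneg (out : Bool) (p : Prog I S) (μ : Cell I → Bool) :
    0 ≤ p.prob G x out μ := by
  induction p generalizing μ with
  | ret b => rw [Prog.prob]; split_ifs <;> norm_num
  | ask q next ih => exact ih _ _
  | write c b next ih => exact ih _
  | call d Q arg next ih =>
    exact Finset.sum_nonneg fun b _ => mul_nonneg (QAlg.prob_nonneg _ _ _) (ih _ _)

theorem Prog.prob_le_one (out : Bool) (p : Prog I S) (μ : Cell I → Bool) :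
    p.prob G x out μ ≤ 1 := by
  induction p generalizing μ with
  | ret b => rw [Prog.prob]; split_ifs <;> norm_num
  | ask q next ih => exact ih _ _
  | write c b next ih => exact ih _
  | call d Q arg next ih =>
    rw [Prog.prob, ← Q.prob_add_prob_not (fun k => (arg k).eval (blackBox G x μ)) true,
      Fintype.sum_bool]
    exact add_le_add (mul_le_of_le_one_right (QAlg.prob_nonneg _ _ _) (ih _ _))
      (mul_le_of_le_one_right (QAlg.prob_nonneg _ _ _) (ih _ _))

/-- Union bound for one gate: either the subroutine errs, or the correct value `b` is stored. -/
theorem prob_gateStep_le {Q : GateAlgs} {c : ℝ} (hQ : Q.IsBoosted c) {k : ℕ} (hk : 1 ≤ k)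
    {h : Gate} (hh : h = Gate.and ∨ h = Gate.or) (cell : Cell I) {d : ℕ} (hd : 1 ≤ d)
    (arg : Fin d → Probe I S) (rest : Prog I S) (out : Bool) (μ : Cell I → Bool) {b : Bool}
    (hb : h.fn (fun l => (arg l).eval (blackBox G x μ)) = b) :
    (gateStep Q k h cell d arg rest).prob G x out μ ≤
      c / 2 ^ k + rest.prob G x out (Function.update μ cell b) := by
  have herr := (hQ h hh k d hk hd).2 (fun l => (arg l).eval (blackBox G x μ))
  rw [hb] at herr
  have hadd := (Q h k d).prob_add_prob_not (fun l => (arg l).eval (blackBox G x μ)) b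
  have h0 := (Q h k d).prob_nonneg (fun l => (arg l).eval (blackBox G x μ))
  have hr0 : ∀ b', 0 ≤ rest.prob G x out (Function.update μ cell b') :=
    fun b' => Prog.prob_nonneg G x out rest _
  have hr1 : ∀ b', rest.prob G x out (Function.update μ cell b') ≤ 1 :=
    fun b' => Prog.prob_le_one G x out rest _
  have hsum : (gateStep Q k h cell d arg rest).prob G x out μ =
      (Q h k d).prob (fun l => (arg l).eval (blackBox G x μ)) b *
        rest.prob G x out (Function.update μ cell b) +
      (Q h k d).prob (fun l => (arg l).eval (blackBox G x μ)) (!b) *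
        rest.prob G x out (Function.update μ cell (!b)) := by
    simp only [gateStep, Prog.prob, Fintype.sum_bool]
    cases b
    · exact add_comm _ _
    · rfl
  rw [hsum]
  have hp1 := h0 b
  have hp2 := h0 (!b)
  have e1 := mul_le_of_le_one_left (hr0 b) (by linarith :
    (Q h k d).prob (fun l => (arg l).eval (blackBox G x μ)) b ≤ 1)
  have e2 := mul_le_of_le_one_right hp2 (hr1 (!b))
  linarith

/-- If the stored values of all later vertices are correct, then up to the error probability of
three gates, processing the vertex `i` stores its correct value. -/
theorem prob_vertexStep_le [Fintype I] (hG : G.IsXorAnd) {Q : GateAlgs} {c : ℝ}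
    (hQ : Q.IsBoosted c) (hc : 0 ≤ c) {k : ℕ} (hk : 1 ≤ k) {i : I} {μ : Cell I → Bool}
    (hμ : ∀ j, i < j → μ (j, 0) = G.innerValue x j) (rest : Prog I S) (out : Bool) :
    ∃ μ' : Cell I → Bool, μ' (i, 0) = G.innerValue x i ∧ (∀ j, j ≠ i → μ' (j, 0) = μ (j, 0)) ∧
      (vertexStep Q k i rest).prob G x out μ ≤ 3 * (c / 2 ^ k) + rest.prob G x out μ' := by
  have hε : 0 ≤ c / 2 ^ k := by positivity
  rcases hG i with hi | ⟨hi, hd⟩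
  · refine ⟨Function.update μ (i, 0) (G.innerValue x i), by simp, fun j hj => by simp [hj], ?_⟩
    have hstep : (vertexStep Q k i rest).prob G x out μ =
        (gateStep Q k .and (i, 0) (G.deg i) (fun l => argProbe i l) rest).prob G x out μ := by
      simp only [vertexStep, Prog.prob, blackBox, hi]
    rw [hstep]
    refine (prob_gateStep_le G x hQ hk (Or.inl rfl) (i, 0) (by linarith [G.two_le_deg i]) _ rest out
      μ (b := G.innerValue x i) ?_).trans (by linarith)
    rw [G.innerValue_eq, hi]
    congr 1
    funext l
    exact eval_argProbe G x hμ l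
  · set A := G.argValue x i ⟨0, by omega⟩ with hA
    set B := G.argValue x i ⟨1, by omega⟩ with hB
    set μ₂ := Function.update μ (i, 2) (!A && B) with hμ₂
    set μ₁ := Function.update μ₂ (i, 1) (A && !B) with hμ₁
    have hA' : ∀ ν : Cell I → Bool, (∀ j, i < j → ν (j, 0) = G.innerValue x j) →
        (argProbe i 0 : Probe I S).eval (blackBox G x ν) = A :=
      fun ν hν => eval_argProbe G x hν ⟨0, by omega⟩
    have hB' : ∀ ν : Cell I → Bool, (∀ j, i < j → ν (j, 0) = G.innerValue x j) →
        (argProbe i 1 : Probe I S).eval (blackBox G x ν) = B :=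
      fun ν hν => eval_argProbe G x hν ⟨1, by omega⟩
    have hμ₂' : ∀ j, i < j → μ₂ (j, 0) = G.innerValue x j := fun j hj => by simp [hμ₂, hμ j hj]
    refine ⟨Function.update μ₁ (i, 0) (G.innerValue x i), by simp,
      fun j hj => by simp [hj, hμ₁, hμ₂], ?_⟩
    have hstep : (vertexStep Q k i rest).prob G x out μ =
        (gateStep Q k .and (i, 2) 2 ![(argProbe i 0).neg, argProbe i 1] <|
          gateStep Q k .and (i, 1) 2 ![argProbe i 0, (argProbe i 1).neg] <|
          gateStep Q k .or (i, 0) 2 ![memProbe (i, 1), memProbe (i, 2)] rest).prob G x out μ := by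
      simp only [vertexStep, Prog.prob, blackBox, hi]
    rw [hstep]
    have s1 := prob_gateStep_le G x hQ hk (Or.inl rfl) (i, 2) one_le_two
      ![(argProbe i 0).neg, argProbe i 1] (gateStep Q k .and (i, 1) 2
        ![argProbe i 0, (argProbe i 1).neg] <|
          gateStep Q k .or (i, 0) 2 ![memProbe (i, 1), memProbe (i, 2)] rest) out μ
      (b := !A && B) (by
        rw [gate_and_fn_two rfl, ← hA' μ hμ, ← hB' μ hμ, ← Probe.eval_neg]; rfl)
    have s2 := prob_gateStep_le G x hQ hk (Or.inl rfl) (i, 1) one_le_two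
      ![argProbe i 0, (argProbe i 1).neg]
      (gateStep Q k .or (i, 0) 2 ![memProbe (i, 1), memProbe (i, 2)] rest) out μ₂
      (b := A && !B) (by
        rw [gate_and_fn_two rfl, ← hA' μ₂ hμ₂', ← hB' μ₂ hμ₂', ← Probe.eval_neg]; rfl)
    have s3 := prob_gateStep_le G x hQ hk (Or.inr rfl) (i, 0) one_le_two
      ![memProbe (i, 1), memProbe (i, 2)] rest out μ₁ (b := G.innerValue x i) (by
        have e1 : μ₁ (i, 1) = (A && !B) := by simp [hμ₁]
        have e2 : μ₁ (i, 2) = (!A && B) := by simp [hμ₁, hμ₂]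
        rw [gate_or_fn_two rfl, G.innerValue_of_xor x hi hd, ← hA, ← hB]
        refine (congrArg₂ or e1 e2).trans ?_
        cases A <;> cases B <;> rfl)
    linarith

/-- The error probability after processing a decreasing list of vertices, if every vertex above a
vertex of the list either comes earlier in the list or has already been stored correctly. -/
theorem prob_foldr_vertexStep_le [Fintype I] (hG : G.IsXorAnd) {Q : GateAlgs} {c : ℝ}
    (hQ : Q.IsBoosted c) (hc : 0 ≤ c) {k : ℕ} (hk : 1 ≤ k) (s : I) (l : List I)
    (hl : l.Pairwise (· > ·)) (μ : Cell I → Bool)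
    (hμ : ∀ j, s ≤ j → j ∉ l → μ (j, 0) = G.innerValue x j) (hs : ∀ i ∈ l, s ≤ i) :
    (l.foldr (vertexStep Q k) (.ask (.mem (s, 0)) fun
      | .bit b => .ret b
      | _ => .ret false)).prob G x (!(G.innerValue x s)) μ ≤ l.length * (3 * (c / 2 ^ k)) := by
  induction l generalizing μ with
  | nil =>
    have h := hμ s le_rfl (by simp)
    simp [Prog.prob, blackBox, h]
  | cons i l ih =>
    rw [List.pairwise_cons] at hl
    have hμi : ∀ j, i < j → μ (j, 0) = G.innerValue x j := fun j hj => by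
      refine hμ j ((hs i (by simp)).trans hj.le) ?_
      rw [List.mem_cons, not_or]
      exact ⟨hj.ne', fun hjl => lt_asymm hj (hl.1 j hjl)⟩
    obtain ⟨μ', h1, h2, h3⟩ := prob_vertexStep_le G x hG hQ hc hk hμi
      (l.foldr (vertexStep Q k) (.ask (.mem (s, 0)) fun
        | .bit b => .ret b
        | _ => .ret false)) (!(G.innerValue x s))
    have h4 := ih hl.2 μ' (fun j hsj hjl => by
      by_cases hji : j = i
      · rw [hji, h1]
      · rw [h2 j hji]
        exact hμ j hsj (by simp [hji, hjl])) fun i' hi' => hs i' (by simp [hi'])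
    rw [List.foldr_cons, List.length_cons]
    push_cast
    refine h3.trans ?_
    linarith

/-! ### The running time -/

theorem time_gateStep_le {Q : GateAlgs} {c : ℝ} (hQ : Q.IsBoosted c) {k : ℕ} (hk : 1 ≤ k)
    {h : Gate} (hh : h = Gate.and ∨ h = Gate.or) (cell : Cell I) {d : ℕ} (hd : 1 ≤ d)
    (arg : Fin d → Probe I S) (rest : Prog I S) {B : ℝ} (μ : Cell I → Bool)
    (harg : ∀ l, (arg l).cost (blackBox G x μ) ≤ 2) (hB : ∀ ν, (rest.time G x ν : ℝ) ≤ B) :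
    ((gateStep Q k h cell d arg rest).time G x μ : ℝ) ≤ 4 * (c * √(k * d)) + 1 + B := by
  have hq := (hQ h hh k d hk hd).1
  have hsup : Finset.univ.sup (fun l => (arg l).cost (blackBox G x μ)) ≤ 2 :=
    Finset.sup_le fun l _ => harg l
  have hsup' : ((Finset.univ.sup (fun l => (arg l).cost (blackBox G x μ)) : ℕ) : ℝ) ≤ 2 := by
    exact_mod_cast hsup
  simp only [gateStep, Prog.time]
  push_cast
  have h1 : ((Q h k d).queries : ℝ) *
      (2 * ((Finset.univ.sup (fun l => (arg l).cost (blackBox G x μ)) : ℕ) : ℝ)) ≤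
      (c * √(k * d)) * (2 * 2) := by
    gcongr
    exact (Nat.cast_nonneg _).trans hq
  have h2 := hB (Function.update μ cell false)
  have h3 := hB (Function.update μ cell true)
  have h4 := max_le (add_le_add_right h2 1) (add_le_add_right h3 1)
  linarith

theorem time_vertexStep_le (hG : G.IsXorAnd) {Q : GateAlgs} {c : ℝ} (hQ : Q.IsBoosted c)
    (hc : 0 ≤ c) {k : ℕ} (hk : 1 ≤ k) (i : I) (rest : Prog I S) {B : ℝ}
    (hB : ∀ ν, (rest.time G x ν : ℝ) ≤ B) (μ : Cell I → Bool) :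
    ((vertexStep Q k i rest).time G x μ : ℝ) ≤ 12 * (c * √(k * G.deg i)) + 4 + B := by
  have hnonneg : 0 ≤ c * √(k * G.deg i) := by positivity
  rcases hG i with hi | ⟨hi, hd⟩
  · have hstep : (vertexStep Q k i rest).time G x μ = 1 + (1 +
        (gateStep Q k .and (i, 0) (G.deg i) (fun l => argProbe i l) rest).time G x μ) := by
      simp only [vertexStep, Prog.time, blackBox, hi]
    rw [hstep]
    have h := time_gateStep_le G x hQ hk (Or.inl rfl) (i, 0) (by linarith [G.two_le_deg i])
      (fun l : Fin (G.deg i) => argProbe i l) rest μ (fun l => cost_argProbe_le G x μ i l) hB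
    push_cast
    linarith
  · have hstep : (vertexStep Q k i rest).time G x μ = 1 +
        (gateStep Q k .and (i, 2) 2 ![(argProbe i 0).neg, argProbe i 1] <|
          gateStep Q k .and (i, 1) 2 ![argProbe i 0, (argProbe i 1).neg] <|
          gateStep Q k .or (i, 0) 2 ![memProbe (i, 1), memProbe (i, 2)] rest).time G x μ := by
      simp only [vertexStep, Prog.time, blackBox, hi]
    rw [hstep, hd]
    have hcost : ∀ ν (p q : Probe I S), p.cost (blackBox G x ν) ≤ 2 →
        q.cost (blackBox G x ν) ≤ 2 → ∀ l, (![p, q] l).cost (blackBox G x ν) ≤ 2 := by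
      intro ν p q hp hq l
      fin_cases l
      · exact hp
      · exact hq
    have h3 := fun ν => time_gateStep_le G x hQ hk (Or.inr rfl) (i, 0) one_le_two
      ![memProbe (i, 1), memProbe (i, 2)] rest ν
      (hcost ν _ _ (by rw [cost_memProbe]; norm_num) (by rw [cost_memProbe]; norm_num)) hB
    have h2 := fun ν => time_gateStep_le G x hQ hk (Or.inl rfl) (i, 1) one_le_two
      ![argProbe i 0, (argProbe i 1).neg] _ ν
      (hcost ν _ _ (cost_argProbe_le G x ν i 0)
        (by rw [Probe.cost_neg]; exact cost_argProbe_le G x ν i 1)) h3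
    have h1 := time_gateStep_le G x hQ hk (Or.inl rfl) (i, 2) one_le_two
      ![(argProbe i 0).neg, argProbe i 1] _ μ
      (hcost μ _ _ (by rw [Probe.cost_neg]; exact cost_argProbe_le G x μ i 0)
        (cost_argProbe_le G x μ i 1)) h2
    push_cast at h1 ⊢
    linarith

theorem time_foldr_vertexStep_le (hG : G.IsXorAnd) {Q : GateAlgs} {c : ℝ} (hQ : Q.IsBoosted c)
    (hc : 0 ≤ c) {k : ℕ} (hk : 1 ≤ k) (last : Prog I S) {B : ℝ}
    (hB : ∀ ν, (last.time G x ν : ℝ) ≤ B) (l : List I) (μ : Cell I → Bool) :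
    ((l.foldr (vertexStep Q k) last).time G x μ : ℝ) ≤
      (l.map fun i => 12 * (c * √(k * G.deg i)) + 4).sum + B := by
  induction l generalizing μ with
  | nil => simpa using hB μ
  | cons i l ih =>
    rw [List.foldr_cons, List.map_cons, List.sum_cons, add_assoc]
    exact time_vertexStep_le G x hG hQ hc hk i _ ih μ

end

/-! ### The bounds for the whole algorithm -/

section

variable {I S : Type} [LinearOrder I] [Fintype I] {N : ℕ} (G : GateDag I S N) (x : Fin N → Bool)

theorem two_mul_card_le_edgeCount : 2 * Fintype.card I ≤ G.edgeCount := by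
  rw [mul_comm, ← smul_eq_mul, ← Finset.card_univ]
  exact Finset.card_nsmul_le_sum _ _ _ fun i _ => G.two_le_deg i

/-- Cauchy-Schwarz: `∑ √dᵢ ≤ √(n̂ m)`. -/
theorem sum_sqrt_deg_le : ∑ i, √(G.deg i : ℝ) ≤ √(Fintype.card I * G.edgeCount) := by
  apply Real.le_sqrt_of_sq_le
  have h := sq_sum_le_card_mul_sum_sq (s := Finset.univ) (f := fun i => √(G.deg i : ℝ))
  refine h.trans_eq ?_
  simp [Finset.card_univ, GateDag.edgeCount]

theorem boosting_bounds {n : ℕ} (hn : 2 ≤ n) :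
    1 ≤ ⌈2 * Real.logb 2 n⌉₊ ∧ (⌈2 * Real.logb 2 n⌉₊ : ℝ) ≤ 5 * Real.log n ∧
      (n : ℝ) ^ 2 ≤ 2 ^ ⌈2 * Real.logb 2 n⌉₊ := by
  have hn' : (2 : ℝ) ≤ n := by exact_mod_cast hn
  have hlog2 := Real.log_two_gt_d9
  have hlog : Real.log 2 ≤ Real.log n := Real.log_le_log (by norm_num) hn'
  have hlb : Real.logb 2 n * Real.log 2 = Real.log n := by
    rw [Real.logb, div_mul_cancel₀]
    linarith
  have hlb1 : 1 ≤ Real.logb 2 n := by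
    rw [Real.le_logb_iff_rpow_le (by norm_num) (by linarith), Real.rpow_one]
    exact hn'
  refine ⟨Nat.one_le_ceil_iff.2 (by linarith), ?_, ?_⟩
  · have := Nat.ceil_lt_add_one (show 0 ≤ 2 * Real.logb 2 (n : ℝ) by linarith)
    nlinarith
  · have h : (2 : ℝ) ^ (2 * Real.logb 2 (n : ℝ)) = (n : ℝ) ^ 2 := by
      rw [mul_comm, Real.rpow_mul (by norm_num), Real.rpow_logb (by norm_num) (by norm_num)
        (by linarith)]
      norm_num
    rw [← h, ← Real.rpow_natCast]
    exact Real.rpow_le_rpow_of_exponent_le (by norm_num) (Nat.le_ceil _)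

theorem time_dagAlgorithm_le (hG : G.IsXorAnd) {Q : GateAlgs} {c : ℝ} (hQ : Q.IsBoosted c)
    (hc : 0 ≤ c) (hn : 2 ≤ Fintype.card I) (s : I) (μ : Cell I → Bool) :
    ((dagAlgorithm Q s : Prog I S).time G x μ : ℝ) ≤
      (36 * c + 5) * √(Fintype.card I * G.edgeCount * Real.log (Fintype.card I)) := by
  obtain ⟨hk1, hk2, -⟩ := boosting_bounds hn
  set n := Fintype.card I with hnI
  set k := ⌈2 * Real.logb 2 (n : ℝ)⌉₊ with hk
  have hn' : (2 : ℝ) ≤ n := by exact_mod_cast hn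
  have hlog2 := Real.log_two_gt_d9
  have hlog : Real.log 2 ≤ Real.log n := Real.log_le_log (by norm_num) hn'
  have hm : (2 : ℝ) * n ≤ G.edgeCount := by exact_mod_cast two_mul_card_le_edgeCount G
  have ht := time_foldr_vertexStep_le G x hG hQ hc hk1 (.ask (.mem (s, 0)) fun
      | .bit b => .ret b
      | _ => .ret false) (B := 1) (fun ν => by simp [Prog.time, blackBox])
      (((Finset.univ : Finset I).filter (s ≤ ·)).sort (· ≥ ·)) μ
  refine ht.trans ?_
  have hlist : ((((Finset.univ : Finset I).filter (s ≤ ·)).sort (· ≥ ·)).map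
      fun i => 12 * (c * √(k * G.deg i)) + 4).sum =
      ∑ i ∈ (Finset.univ : Finset I).filter (s ≤ ·), (12 * (c * √(k * G.deg i)) + 4) := by
    rw [← List.sum_toFinset _ (Finset.sort_nodup _ _), Finset.sort_toFinset]
  have hall : ∑ i ∈ (Finset.univ : Finset I).filter (s ≤ ·), (12 * (c * √(k * G.deg i)) + 4) ≤
      ∑ i, (12 * (c * √(k * G.deg i)) + 4) :=
    Finset.sum_le_sum_of_subset_of_nonneg (Finset.subset_univ _) fun i _ _ => by positivity
  have hsum : ∑ i, (12 * (c * √(k * G.deg i)) + 4) = 12 * c * √k * ∑ i, √(G.deg i : ℝ) + 4 * n := by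
    rw [Finset.sum_add_distrib, Finset.mul_sum, Finset.sum_const, Finset.card_univ, nsmul_eq_mul,
      mul_comm (4 : ℝ)]
    congr 1
    refine Finset.sum_congr rfl fun i _ => ?_
    rw [Real.sqrt_mul (by positivity)]
    ring
  have hsqrtk : √(k : ℝ) ≤ 3 * √(Real.log n) := by
    rw [Real.sqrt_le_left (by positivity), mul_pow, Real.sq_sqrt (by linarith)]
    linarith
  set R := √((n : ℝ) * G.edgeCount * Real.log n) with hR
  have hR1 : √(n * G.edgeCount : ℝ) * √(Real.log n) = R := by
    rw [hR, ← Real.sqrt_mul (by positivity)]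
  have hmain : 12 * c * √k * ∑ i, √(G.deg i : ℝ) ≤ 36 * c * R := by
    calc 12 * c * √k * ∑ i, √(G.deg i : ℝ)
        ≤ 12 * c * (3 * √(Real.log n)) * √(n * G.edgeCount) := by
          gcongr
          exact sum_sqrt_deg_le G
      _ = 36 * c * R := by rw [← hR1]; ring
  have hnR : (n : ℝ) ≤ R := by
    apply Real.le_sqrt_of_sq_le
    have e1 : (n : ℝ) * (2 * n) * (1 / 2) ≤ n * G.edgeCount * Real.log n := by
      gcongr
      linarith
    linarith
  rw [hlist]
  linarith

theorem prob_dagAlgorithm_le (hG : G.IsXorAnd) {Q : GateAlgs} {c : ℝ} (hQ : Q.IsBoosted c)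
    (hc : 0 ≤ c) (hn : 2 ≤ Fintype.card I) (s : I) (μ : Cell I → Bool) :
    (dagAlgorithm Q s : Prog I S).prob G x (!(G.innerValue x s)) μ ≤
      3 * c / Fintype.card I := by
  obtain ⟨hk1, -, hk3⟩ := boosting_bounds hn
  set n := Fintype.card I with hnI
  set k := ⌈2 * Real.logb 2 (n : ℝ)⌉₊ with hk
  have hn' : (2 : ℝ) ≤ n := by exact_mod_cast hn
  have hp := prob_foldr_vertexStep_le G x hG hQ hc hk1 s
    (((Finset.univ : Finset I).filter (s ≤ ·)).sort (· ≥ ·)) (Finset.sortedGT_sort _).pairwise μ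
    (fun j hj hjl => absurd (by simpa using hj) hjl) (fun i hi => by simpa using hi)
  refine hp.trans ?_
  rw [Finset.length_sort]
  have hcard : ((((Finset.univ : Finset I).filter (s ≤ ·)).card : ℕ) : ℝ) ≤ n := by
    exact_mod_cast Finset.card_le_univ _
  calc _ ≤ (n : ℝ) * (3 * (c / n ^ 2)) := by gcongr
    _ = 3 * c / n := by field_simp

end

/-! ### Both parts together -/

theorem theorem3 :
    (∀ (nhat l N : ℕ) (G : GateDag (Fin nhat) (Fin l) N), G.IsXorAnd →
      G.replaceXor.IsAndOrNot ∧
      Fintype.card G.NewInner ≤ 3 * nhat ∧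
      G.replaceXor.edgeCount ≤ 6 * G.edgeCount ∧
      ∀ x : Fin N → Bool, G.replaceXor.value x = G.value x) ∧
    ∃ (Q : GateAlgs) (c C : ℝ), 0 < c ∧ 0 < C ∧ Q.IsBoosted c ∧
      ∀ (nhat l N : ℕ) (G : GateDag (Fin nhat) (Fin l) N), G.IsXorAnd → 2 ≤ nhat →
        ∀ x : Fin N → Bool,
          (((dagAlgorithm Q G.root).time G x (fun _ => false) : ℕ) : ℝ)
              ≤ C * √(nhat * G.edgeCount * Real.log nhat) ∧
          (((dagAlgorithm Q G.root).time G x (fun _ => false) : ℕ) : ℝ)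
              ≤ C * √(((nhat + l : ℕ) : ℝ) * G.edgeCount * Real.log ((nhat + l : ℕ) : ℝ)) ∧
          (dagAlgorithm Q G.root).prob G x (!(G.value x)) (fun _ => false) ≤ C / nhat := by
  refine ⟨fun nhat l N G hG => ⟨G.isAndOrNot_replaceXor hG, ?_, ?_, fun x =>
    G.value_replaceXor x hG⟩, ?_⟩
  · simpa using G.card_newInner_le
  · have := G.edgeCount_replaceXor_le
    omega
  obtain ⟨Q, hQ⟩ := exists_boosted
  refine ⟨Q, 36, 1301, by norm_num, by norm_num, hQ, fun nhat l N G hG hn x => ?_⟩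
  have hcard : 2 ≤ Fintype.card (Fin nhat) := by simpa using hn
  have ht := time_dagAlgorithm_le G x hG hQ (by norm_num) hcard G.root (fun _ => false)
  have hp := prob_dagAlgorithm_le G x hG hQ (by norm_num) hcard G.root (fun _ => false)
  rw [Fintype.card_fin] at ht hp
  norm_num only at ht hp
  refine ⟨ht, ht.trans ?_, hp.trans ?_⟩
  · have h1 : (1 : ℝ) ≤ nhat := by exact_mod_cast (by omega : 1 ≤ nhat)
    have h2 : (nhat : ℝ) ≤ ((nhat + l : ℕ) : ℝ) := by exact_mod_cast Nat.le_add_right _ _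
    have h3 := Real.log_nonneg h1
    gcongr
  · gcongr
    norm_num
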